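/- Let $m\ge 0$ be an integer and let $a,b,c_1,\dots,c_m\in\mathbb{C}$ be arbitrary parameters. Let $D^{(h)}=\mathbb{C}[h]\langle x_1,\dots,x_m,\partial_1,\dots,\partial_m\rangle$ be the homogenized Weyl algebra: $h$ is central, the $x_i$ commute with each other, the $\partial_i$ commute with each other, and $\partial_i x_j=x_j\partial_i+\delta_{ij}h^2$. The normally ordered monomials $h^kx^\alpha\partial^\beta$ form a $\mathbb{C}$-basis of $D^{(h)}$. Order them by $\succ_{(-1,1)}$: compare first the total degree $k+|\alpha|+|\beta|$, then the weight $|\beta|-|\alpha|$ (weight vector $(-1,\dots,-1,1,\dots,1)$), and break ties by the lexicographic order with $\partial_1\succ\cdots\succ\partial_m\succ x_1\succ\cdots\succ x_m$. Put $\theta_i=x_i\partial_i$ and $$S_i=\theta_i\bigl(\theta_i+(c_i-1)h^2\bigr),\qquad S_{ab}=\Bigl(\sum_{i=1}^m\theta_i+ah^2\Bigr)\Bigl(\sum_{i=1}^m\theta_i+bh^2\Bigr),$$ $$T_i=hS_i-x_iS_{ab},\qquad T_{ij}=x_jS_i-x_iS_j .$$ ($T_i$ and $T_{ij}$ are the homogenizations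 of $\ell_i=\theta_i(\theta_i+c_i-1)-x_i(\theta_1+\cdots+\theta_m+a)(\theta_1+\cdots+\theta_m+b)$ and of $x_j\ell_i-x_i\ell_j$.) For $0\ne f\in D^{(h)}$ with leading monomial $h^kx^\alpha\partial^\beta$ and leading coefficient $f_0$, put $\mathrm{in}(f)=f_0h^kx^\alpha\xi^\beta\in\mathbb{C}[h,x,\xi]$. For nonzero $f,g$ whose leading monomials have exponent vectors $s,t$ and whose leading coefficients are $f_0,g_0$, the S-pair is $\mathrm{sp}(f,g)=g_0M_{u-s}f-f_0M_{u-t}g$, where $u$ is the componentwise maximum of $s,t$ and $M_{(k,\alpha,\beta)}=h^kx^\alpha\partial^\beta$. A standard representation of $f$ with respect to $G\subset D^{(h)}$ is a finite expression $f=\sum_{g\in G}q_g g$, $q_g\in D^{(h)}$, such that, whenever $q_g\neq0$, the leading monomial of $q_gg$ is $\preceq$ the leading monomial of $f$ (for $f=0$: all $q_gg=0$). **Theorem.** The set $G=\{T_i\mid 1\le i\le m\}\cup\{T_{ij}\mid 1\le i<j\le m\}$ satisfies the S-pair criterion in $D^{(h)}$: for all $f,g\in G$ the S-pair $\mathrm{sp}(f,g)$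 has a standard representation with respect to $G$. Moreover $G$ is a Gröbner basis, with respect to $\succ_{(-1,1)}$, of the left ideal $I=D^{(h)}G$ that it generates: the ideal of $\mathbb{C}[h,x,\xi]$ generated by all $\mathrm{in}(f)$, $0\neq f\in I$, is generated by the elements $\mathrm{in}(g)$, $g\in G$. -/

import Mathlib

open MvPolynomial

noncomputable section

namespace LauricellaFC

/-- The generators of the homogenized Weyl algebra in `m` variables: the homogenization variable
`h`, the coordinates `x_i` and the derivations `d_i = ∂_i`. The same type indexes the variables
`h, x_i, ξ_i` of the commutative polynomial ring in which symbols live. -/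
inductive HVar (m : ℕ) : Type
  | h : HVar m
  | x (i : Fin m) : HVar m
  | d (i : Fin m) : HVar m

open HVar

/-- The defining relations of the homogenized Weyl algebra. -/
inductive HRel (m : ℕ) : FreeAlgebra ℂ (HVar m) → FreeAlgebra ℂ (HVar m) → Prop
  | h_comm (v : HVar m) :
      HRel m (FreeAlgebra.ι ℂ h * FreeAlgebra.ι ℂ v) (FreeAlgebra.ι ℂ v * FreeAlgebra.ι ℂ h)
  | x_comm (i j : Fin m) :
      HRel m (FreeAlgebra.ι ℂ (x i) * FreeAlgebra.ι ℂ (x j))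
        (FreeAlgebra.ι ℂ (x j) * FreeAlgebra.ι ℂ (x i))
  | d_comm (i j : Fin m) :
      HRel m (FreeAlgebra.ι ℂ (d i) * FreeAlgebra.ι ℂ (d j))
        (FreeAlgebra.ι ℂ (d j) * FreeAlgebra.ι ℂ (d i))
  | d_x_of_ne (i j : Fin m) (hij : i ≠ j) :
      HRel m (FreeAlgebra.ι ℂ (d i) * FreeAlgebra.ι ℂ (x j))
        (FreeAlgebra.ι ℂ (x j) * FreeAlgebra.ι ℂ (d i))
  | d_x_self (i : Fin m) :
      HRel m (FreeAlgebra.ι ℂ (d i) * FreeAlgebra.ι ℂ (x i))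
        (FreeAlgebra.ι ℂ (x i) * FreeAlgebra.ι ℂ (d i) + FreeAlgebra.ι ℂ h ^ 2)

/-- The homogenized Weyl algebra `D^(h) = ℂ[h]⟨x_1, …, x_m, ∂_1, …, ∂_m⟩`. -/
abbrev HWeyl (m : ℕ) : Type := RingQuot (HRel m)

/-- The image of a generator in `D^(h)`. -/
def gen {m : ℕ} (v : HVar m) : HWeyl m := RingQuot.mkAlgHom ℂ (HRel m) (FreeAlgebra.ι ℂ v)

lemma gen_rel {m : ℕ} {p q : FreeAlgebra ℂ (HVar m)} (hpq : HRel m p q) :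
    RingQuot.mkAlgHom ℂ (HRel m) p = RingQuot.mkAlgHom ℂ (HRel m) q :=
  RingQuot.mkAlgHom_rel ℂ hpq

lemma h_mul {m : ℕ} (v : HVar m) : gen h * gen v = gen v * gen h := by
  simpa [gen] using gen_rel (HRel.h_comm v)

lemma x_mul_x {m : ℕ} (i j : Fin m) : gen (x i) * gen (x j) = gen (x j) * gen (x i) := by
  simpa [gen] using gen_rel (HRel.x_comm i j)

lemma d_mul_d {m : ℕ} (i j : Fin m) : gen (d i) * gen (d j) = gen (d j) * gen (d i) := by
  simpa [gen] using gen_rel (HRel.d_comm i j)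

lemma d_mul_x {m : ℕ} (i j : Fin m) :
    gen (d i) * gen (x j) = gen (x j) * gen (d i) + if i = j then gen h ^ 2 else 0 := by
  split_ifs with hij
  · subst hij
    simpa [gen] using gen_rel (HRel.d_x_self i)
  · simpa [gen] using gen_rel (HRel.d_x_of_ne i j hij)

/-! ### Normally ordered expressions -/

/-- The normally ordered monomial `h^k x^α ∂^β` with exponent vector `s = (k, α, β)`. -/
def normalMonomial {m : ℕ} (s : HVar m →₀ ℕ) : HWeyl m :=
  gen h ^ s h * ((List.finRange m).map fun i => gen (x i) ^ s (x i)).prod *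
    ((List.finRange m).map fun i => gen (d i) ^ s (d i)).prod

/-- The linear map which sends the commutative monomial `h^k x^α ξ^β` to `h^k x^α ∂^β`. -/
def normalOrder (m : ℕ) : MvPolynomial (HVar m) ℂ →ₗ[ℂ] HWeyl m :=
  (MvPolynomial.basisMonomials (HVar m) ℂ).constr ℂ normalMonomial

lemma normalOrder_monomial {m : ℕ} (s : HVar m →₀ ℕ) :
    normalOrder m (monomial s 1) = normalMonomial s := by
  have := (MvPolynomial.basisMonomials (HVar m) ℂ).constr_basis ℂ normalMonomial s
  simpa [normalOrder] using this

lemma list_prod_comm {A ι : Type*} [Monoid A] (g : ι → A) (b : A)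
    (hb : ∀ i, Commute b (g i)) (s : ι → ℕ) (l : List ι) :
    Commute b (l.map fun i => g i ^ s i).prod := by
  induction l with
  | nil => simp
  | cons i l ih => simpa using ((hb i).pow_right _).mul_right ih

lemma list_prod_add {A ι : Type*} [Monoid A] (g : ι → A)
    (hg : ∀ i j, Commute (g i) (g j)) (s t : ι → ℕ) (l : List ι) :
    (l.map fun i => g i ^ (s i + t i)).prod =
      (l.map fun i => g i ^ s i).prod * (l.map fun i => g i ^ t i).prod := by
  induction l with
  | nil => simp
  | cons i l ih =>
    have hc : Commute (g i ^ t i) (l.map fun i => g i ^ s i).prod :=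
      list_prod_comm g _ (fun j => (hg i j).pow_left _) s l
    simp only [List.map_cons, List.prod_cons]
    rw [ih, pow_add, mul_assoc, mul_assoc, ← mul_assoc (g i ^ t i), hc.eq, mul_assoc]

lemma list_prod_single {A : Type*} [Monoid A] {m : ℕ} (g : Fin m → A) (j : Fin m) :
    ((List.finRange m).map fun i => g i ^ (Pi.single j 1 : Fin m → ℕ) i).prod = g j := by
  have key : ∀ l : List (Fin m), l.Nodup →
      (l.map fun i => g i ^ (Pi.single j 1 : Fin m → ℕ) i).prod = if j ∈ l then g j else 1 := by
    intro l
    induction l with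
    | nil => simp
    | cons i l ih =>
      intro hl
      rw [List.nodup_cons] at hl
      rw [List.map_cons, List.prod_cons, ih hl.2]
      by_cases hij : j = i
      · subst hij
        simp [hl.1]
      · simp [hij]
  rw [key _ (List.nodup_finRange m)]
  simp

lemma normalMonomial_h {m : ℕ} (s : HVar m →₀ ℕ) :
    normalMonomial (Finsupp.single h 1 + s) = gen h * normalMonomial s := by
  simp [normalMonomial, pow_add, mul_assoc]

lemma normalMonomial_x {m : ℕ} (j : Fin m) (s : HVar m →₀ ℕ) :
    normalMonomial (Finsupp.single (x j) 1 + s) = gen (x j) * normalMonomial s := by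
  classical
  have e : ∀ i, (Finsupp.single (x j) 1 + s : HVar m →₀ ℕ) (x i) =
      (Pi.single j 1 : Fin m → ℕ) i + s (x i) := by
    intro i
    by_cases hij : i = j
    · subst hij; simp
    · simp [hij]
  have hc : Commute (gen (h : HVar m) ^ s h) (gen (x j)) :=
    Commute.pow_left (h_mul (x j)) _
  simp only [normalMonomial, e]
  rw [list_prod_add (fun i => gen (x i)) (fun i k => x_mul_x i k), list_prod_single]
  simp only [Finsupp.add_apply, ne_eq, reduceCtorEq, not_false_eq_true, Finsupp.single_eq_of_ne,
    zero_add]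
  rw [← mul_assoc, hc.eq]
  simp only [mul_assoc]

lemma normalMonomial_d {m : ℕ} (j : Fin m) (s : HVar m →₀ ℕ) (hs : s h = 0)
    (hx : ∀ i, s (x i) = 0) :
    normalMonomial (Finsupp.single (d j) 1 + s) = gen (d j) * normalMonomial s := by
  classical
  have e : ∀ i, (Finsupp.single (d j) 1 + s : HVar m →₀ ℕ) (d i) =
      (Pi.single j 1 : Fin m → ℕ) i + s (d i) := by
    intro i
    by_cases hij : i = j
    · subst hij; simp
    · simp [hij]
  simp only [normalMonomial, e]
  rw [list_prod_add (fun i => gen (d i)) (fun i k => d_mul_d i k), list_prod_single]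
  simp [hs, hx]

lemma normalOrder_X_mul {m : ℕ} (v : HVar m)
    (hv : ∀ s, normalMonomial (Finsupp.single v 1 + s) = gen v * normalMonomial s)
    (p : MvPolynomial (HVar m) ℂ) : normalOrder m (X v * p) = gen v * normalOrder m p := by
  have key : (normalOrder m).comp (LinearMap.mulLeft ℂ (X v)) =
      (LinearMap.mulLeft ℂ (gen v)).comp (normalOrder m) := by
    refine (MvPolynomial.basisMonomials (HVar m) ℂ).ext fun s => ?_
    simp only [coe_basisMonomials, LinearMap.comp_apply, LinearMap.mulLeft_apply]
    rw [normalOrder_monomial, ← hv, ← normalOrder_monomial, X, monomial_mul, one_mul]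
  exact LinearMap.congr_fun key p

/-! ### Existence and uniqueness of the normally ordered expression -/

/-- The action of a generator on normally ordered expressions: `h` and `x_i` act by
multiplication, `∂_i` acts as `ξ_i + h² ∂/∂x_i`. -/
def genAct {m : ℕ} : HVar m → Module.End ℂ (MvPolynomial (HVar m) ℂ)
  | h => LinearMap.mulLeft ℂ (X h)
  | x i => LinearMap.mulLeft ℂ (X (x i))
  | d i => LinearMap.mulLeft ℂ (X (d i)) +
      LinearMap.mulLeft ℂ (X h ^ 2) ∘ₗ (pderiv (x i)).toLinearMap

lemma genAct_h {m : ℕ} (p : MvPolynomial (HVar m) ℂ) : genAct h p = X h * p := rfl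

lemma genAct_x {m : ℕ} (i : Fin m) (p : MvPolynomial (HVar m) ℂ) :
    genAct (x i) p = X (x i) * p := rfl

lemma genAct_d {m : ℕ} (i : Fin m) (p : MvPolynomial (HVar m) ℂ) :
    genAct (d i) p = X (d i) * p + X h ^ 2 * pderiv (x i) p := rfl

lemma pderiv_comm' {σ : Type*} (u v : σ) (p : MvPolynomial σ ℂ) :
    pderiv u (pderiv v p) = pderiv v (pderiv u p) := by
  classical
  have key : ⁅(pderiv u : Derivation ℂ (MvPolynomial σ ℂ) (MvPolynomial σ ℂ)),
      (pderiv v : Derivation ℂ (MvPolynomial σ ℂ) (MvPolynomial σ ℂ))⁆ = 0 := by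
    refine MvPolynomial.derivation_ext fun w => ?_
    simp only [Derivation.commutator_apply, pderiv_X, Derivation.zero_apply]
    rcases eq_or_ne w u with rfl | hu <;> rcases eq_or_ne w v with rfl | hv <;>
      simp [Pi.single_apply, *]
  have := congrArg (fun D => D p) key
  simpa [Derivation.commutator_apply, sub_eq_zero] using this

lemma genAct_rel {m : ℕ} ⦃p q : FreeAlgebra ℂ (HVar m)⦄ (hpq : HRel m p q) :
    FreeAlgebra.lift ℂ genAct p = FreeAlgebra.lift ℂ genAct q := by
  classical
  induction hpq with
  | h_comm v =>
    refine LinearMap.ext fun p => ?_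
    cases v <;> simp [genAct_h, genAct_x, genAct_d, pderiv_X] <;> ring
  | x_comm i j =>
    refine LinearMap.ext fun p => ?_
    simp [genAct_x]; ring
  | d_comm i j =>
    refine LinearMap.ext fun p => ?_
    simp [genAct_d, pderiv_X]
    rw [pderiv_comm' (x j) (x i)]; ring
  | d_x_of_ne i j hij =>
    refine LinearMap.ext fun p => ?_
    simp [genAct_x, genAct_d, pderiv_X, Ne.symm hij]; ring
  | d_x_self i =>
    refine LinearMap.ext fun p => ?_
    simp [genAct_h, genAct_x, genAct_d, pderiv_X, pow_two]; ring

/-- The left regular representation, written on normally ordered expressions. -/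
def act (m : ℕ) : HWeyl m →ₐ[ℂ] Module.End ℂ (MvPolynomial (HVar m) ℂ) :=
  RingQuot.liftAlgHom ℂ ⟨FreeAlgebra.lift ℂ genAct, genAct_rel⟩

lemma act_gen {m : ℕ} (v : HVar m) : act m (gen v) = genAct v := by
  simp [act, gen]

lemma monomial_peel {m : ℕ} (s : HVar m →₀ ℕ) (v : HVar m) (hv : s v ≠ 0) :
    ∃ t, s = Finsupp.single v 1 + t ∧
      (monomial s 1 : MvPolynomial (HVar m) ℂ) = X v * monomial t 1 ∧ t.degree < s.degree := by
  classical
  have hle : Finsupp.single v 1 ≤ s := by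
    rw [Finsupp.single_le_iff]; omega
  have e : s = Finsupp.single v 1 + (s - Finsupp.single v 1) := (add_tsub_cancel_of_le hle).symm
  refine ⟨s - Finsupp.single v 1, e, ?_, ?_⟩
  · rw [X, monomial_mul, one_mul, ← e]
  · have := congrArg Finsupp.degree e
    rw [map_add, Finsupp.degree_single] at this
    omega

lemma pderiv_monomial_zero {m : ℕ} (s : HVar m →₀ ℕ) (v : HVar m) (hv : s v = 0) :
    pderiv v (monomial s 1 : MvPolynomial (HVar m) ℂ) = 0 := by
  rw [pderiv_monomial, hv]; simp

lemma normalOrder_d_monomial {m : ℕ} (i : Fin m) (n : ℕ) :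
    ∀ s : HVar m →₀ ℕ, s.degree = n →
      normalOrder m (genAct (d i) (monomial s 1)) = gen (d i) * normalOrder m (monomial s 1) := by
  classical
  induction n using Nat.strong_induction_on with
  | _ n ih =>
  intro s hn
  by_cases hs : s h = 0
  · by_cases hx : ∀ j, s (x j) = 0
    · rw [genAct_d, pderiv_monomial_zero _ _ (hx i), mul_zero, add_zero, X, monomial_mul, one_mul,
        normalOrder_monomial, normalOrder_monomial, normalMonomial_d i s hs hx]
    · push Not at hx
      obtain ⟨j, hj⟩ := hx
      obtain ⟨t, -, ht, hlt⟩ := monomial_peel s (x j) hj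
      have hc : genAct (d i) (X (x j) * monomial t 1) =
          X (x j) * genAct (d i) (monomial t 1) +
            if i = j then X h * (X h * (monomial t 1 : MvPolynomial (HVar m) ℂ)) else 0 := by
        rw [genAct_d, genAct_d]
        split_ifs with hij
        · subst hij; simp; ring
        · simp [pderiv_X, Ne.symm hij]; ring
      rw [ht, hc, map_add, normalOrder_X_mul _ (normalMonomial_x j), ih _ (hn ▸ hlt) t rfl,
        normalOrder_X_mul _ (normalMonomial_x j), ← mul_assoc,
        ← mul_assoc (gen (d i)), d_mul_x, add_mul]
      congr 1
      split_ifs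
      · rw [normalOrder_X_mul _ normalMonomial_h, normalOrder_X_mul _ normalMonomial_h, pow_two,
          mul_assoc]
      · simp
  · obtain ⟨t, -, ht, hlt⟩ := monomial_peel s h hs
    have hc : genAct (d i) (X h * monomial t 1) =
        X h * genAct (d i) (monomial t 1 : MvPolynomial (HVar m) ℂ) := by
      rw [genAct_d, genAct_d]
      simp [pderiv_X]; ring
    rw [ht, hc, normalOrder_X_mul _ normalMonomial_h, ih _ (hn ▸ hlt) t rfl,
      normalOrder_X_mul _ normalMonomial_h, ← mul_assoc, ← mul_assoc, h_mul]

lemma normalOrder_genAct {m : ℕ} (v : HVar m) (p : MvPolynomial (HVar m) ℂ) :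
    normalOrder m (genAct v p) = gen v * normalOrder m p := by
  cases v with
  | h => exact normalOrder_X_mul _ normalMonomial_h p
  | x i => exact normalOrder_X_mul _ (normalMonomial_x i) p
  | d i =>
    have key : (normalOrder m).comp (genAct (d i)) =
        (LinearMap.mulLeft ℂ (gen (d i))).comp (normalOrder m) := by
      refine (MvPolynomial.basisMonomials (HVar m) ℂ).ext fun s => ?_
      simpa using normalOrder_d_monomial i _ s rfl
    exact LinearMap.congr_fun key p

lemma normalOrder_act {m : ℕ} (f : HWeyl m) (p : MvPolynomial (HVar m) ℂ) :
    normalOrder m (act m f p) = f * normalOrder m p := by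
  obtain ⟨f, rfl⟩ := RingQuot.mkAlgHom_surjective ℂ (HRel m) f
  induction f using FreeAlgebra.induction generalizing p with
  | grade0 r => simp [Algebra.algebraMap_eq_smul_one]
  | grade1 v =>
    change normalOrder m (act m (gen v) p) = gen v * _
    rw [act_gen, normalOrder_genAct]
  | mul f g hf hg => rw [map_mul, map_mul, Module.End.mul_apply, hf, hg, mul_assoc]
  | add f g hf hg => rw [map_add, map_add, LinearMap.add_apply, map_add, hf, hg, add_mul]

lemma normalMonomial_zero (m : ℕ) : normalMonomial (0 : HVar m →₀ ℕ) = 1 := by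
  simp [normalMonomial]

lemma normalOrder_one (m : ℕ) : normalOrder m 1 = 1 := by
  rw [← normalMonomial_zero, ← normalOrder_monomial]; rfl

lemma act_normalMonomial {m : ℕ} (n : ℕ) :
    ∀ s : HVar m →₀ ℕ, s.degree = n → act m (normalMonomial s) 1 = monomial s 1 := by
  classical
  induction n using Nat.strong_induction_on with
  | _ n ih =>
  intro s hn
  by_cases hs : s h = 0
  · by_cases hx : ∀ j, s (x j) = 0
    · by_cases hd : ∀ j, s (d j) = 0
      · have : s = 0 := by
          ext v
          cases v <;> simp [hs, hx, hd]
        subst this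
        rw [normalMonomial_zero]; simp
      · push Not at hd
        obtain ⟨j, hj⟩ := hd
        obtain ⟨t, hst, ht, hlt⟩ := monomial_peel s (d j) hj
        have h1 : t h = 0 := by simpa [hs] using (DFunLike.congr_fun hst h).symm
        have h2 : ∀ i, t (x i) = 0 := fun i => by
          simpa [hx i] using (DFunLike.congr_fun hst (x i)).symm
        rw [ht, hst, normalMonomial_d j t h1 h2, map_mul, Module.End.mul_apply,
          ih _ (hn ▸ hlt) t rfl, act_gen, genAct_d, pderiv_monomial_zero _ _ (h2 j)]
        simp
    · push Not at hx
      obtain ⟨j, hj⟩ := hx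
      obtain ⟨t, hst, ht, hlt⟩ := monomial_peel s (x j) hj
      rw [ht, hst, normalMonomial_x, map_mul, Module.End.mul_apply, ih _ (hn ▸ hlt) t rfl, act_gen,
        genAct_x]
  · obtain ⟨t, hst, ht, hlt⟩ := monomial_peel s h hs
    rw [ht, hst, normalMonomial_h, map_mul, Module.End.mul_apply, ih _ (hn ▸ hlt) t rfl, act_gen,
      genAct_h]

lemma act_normalOrder {m : ℕ} (p : MvPolynomial (HVar m) ℂ) : act m (normalOrder m p) 1 = p := by
  have key : (LinearMap.applyₗ (1 : MvPolynomial (HVar m) ℂ)).comp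
      ((act m).toLinearMap.comp (normalOrder m)) = LinearMap.id := by
    refine (MvPolynomial.basisMonomials (HVar m) ℂ).ext fun s => ?_
    simpa [normalOrder_monomial] using act_normalMonomial _ s rfl
  exact LinearMap.congr_fun key p

/-- Every element of `D^(h)` has exactly one normally ordered expression: the monomials
`h^k x^α ∂^β` form a `ℂ`-basis of `D^(h)`. -/
def normalOrderEquiv (m : ℕ) : MvPolynomial (HVar m) ℂ ≃ₗ[ℂ] HWeyl m :=
  LinearEquiv.ofBijective (normalOrder m)
    ⟨Function.LeftInverse.injective (g := fun f => act m f 1) act_normalOrder,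
      fun f => ⟨act m f 1, by rw [normalOrder_act, normalOrder_one, mul_one]⟩⟩

/-- The total symbol of `f`: if `f = ∑ c_{kαβ} h^k x^α ∂^β`, then its symbol is the polynomial
`∑ c_{kαβ} h^k x^α ξ^β`. -/
def symbol {m : ℕ} (f : HWeyl m) : MvPolynomial (HVar m) ℂ := (normalOrderEquiv m).symm f

/-! ### The monomial order -/

/-- The exponent vectors `(k, α, β)` of the monomials `h^k x^α ∂^β`, as the carrier of the
order defined below. -/
def KMExp (m : ℕ) : Type := HVar m →₀ ℕ

instance (m : ℕ) : AddCommMonoid (KMExp m) := inferInstanceAs (AddCommMonoid (HVar m →₀ ℕ))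

/-- Monomials `h^k x^α ∂^β` are compared first by total degree `k + |α| + |β|`, then by the weight
`|β| - |α|` (weight vector `(-1, …, -1, 1, …, 1)`), then lexicographically with
`∂_1 ≻ ⋯ ≻ ∂_m ≻ x_1 ≻ ⋯ ≻ x_m`. -/
def kmKey {m : ℕ} (s : HVar m →₀ ℕ) : ℕ ×ₗ ℤ ×ₗ Lex (Fin m → ℕ) ×ₗ Lex (Fin m → ℕ) :=
  toLex (s h + ∑ i, s (x i) + ∑ i, s (d i),
    toLex (∑ i, (s (d i) : ℤ) - ∑ i, (s (x i) : ℤ),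
      toLex (toLex fun i => s (d i), toLex fun i => s (x i))))

lemma kmKey_injective (m : ℕ) : Function.Injective (kmKey (m := m)) := by
  intro s t hst
  have h1 : s h + ∑ i, s (x i) + ∑ i, s (d i) = t h + ∑ i, t (x i) + ∑ i, t (d i) :=
    congrArg (fun p : ℕ ×ₗ ℤ ×ₗ Lex (Fin m → ℕ) ×ₗ Lex (Fin m → ℕ) => p.1) hst
  have h2 : (fun i => s (d i)) = fun i => t (d i) :=
    congrArg (fun p : ℕ ×ₗ ℤ ×ₗ Lex (Fin m → ℕ) ×ₗ Lex (Fin m → ℕ) => (p.2.2.1 : Fin m → ℕ)) hst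
  have h3 : (fun i => s (x i)) = fun i => t (x i) :=
    congrArg (fun p : ℕ ×ₗ ℤ ×ₗ Lex (Fin m → ℕ) ×ₗ Lex (Fin m → ℕ) => (p.2.2.2 : Fin m → ℕ)) hst
  have h1' : s h = t h := by
    simp only [fun i => congrFun h2 i, fun i => congrFun h3 i] at h1
    omega
  refine Finsupp.ext fun v => ?_
  cases v with
  | h => exact h1'
  | x i => exact congrFun h3 i
  | d i => exact congrFun h2 i

lemma kmKey_add {m : ℕ} (s t : HVar m →₀ ℕ) : kmKey (s + t) = kmKey s + kmKey t := by
  have e : ∀ v, (s + t) v = s v + t v := fun v => Finsupp.add_apply s t v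
  refine Prod.ext ?_ (Prod.ext ?_ (Prod.ext ?_ ?_))
  · change (s + t) h + ∑ i, (s + t) (x i) + ∑ i, (s + t) (d i) =
      (s h + ∑ i, s (x i) + ∑ i, s (d i)) + (t h + ∑ i, t (x i) + ∑ i, t (d i))
    simp only [e, Finset.sum_add_distrib]; ring
  · change ∑ i, ((s + t) (d i) : ℤ) - ∑ i, ((s + t) (x i) : ℤ) =
      (∑ i, (s (d i) : ℤ) - ∑ i, (s (x i) : ℤ)) + (∑ i, (t (d i) : ℤ) - ∑ i, (t (x i) : ℤ))
    simp only [e, Nat.cast_add, Finset.sum_add_distrib]; ring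
  · exact funext fun i => e (d i)
  · exact funext fun i => e (x i)

instance (m : ℕ) : LinearOrder (KMExp m) := 
  LinearOrder.lift' (fun s : HVar m →₀ ℕ => kmKey s) (kmKey_injective m)

lemma kmExp_le_iff {m : ℕ} (s t : HVar m →₀ ℕ) :
    @LE.le (KMExp m) _ s t ↔ kmKey s ≤ kmKey t := Iff.rfl

instance (m : ℕ) : IsOrderedAddMonoid (KMExp m) where
  add_le_add_left s t hst u := by
    have hst' : kmKey (m := m) s ≤ kmKey (m := m) t := hst
    refine (kmExp_le_iff (m := m) _ _).2 ?_
    exact ((kmKey_add (m := m) s u).trans_le (add_le_add_left hst' _)).trans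
      (kmKey_add (m := m) t u).ge

lemma kmKey_zero_le {m : ℕ} (s : HVar m →₀ ℕ) : kmKey (0 : HVar m →₀ ℕ) ≤ kmKey s := by
  by_cases h0 : s h + ∑ i, s (x i) + ∑ i, s (d i) = 0
  · have hs : s = 0 := by
      simp only [Nat.add_eq_zero_iff, Finset.sum_eq_zero_iff, Finset.mem_univ, true_imp_iff] at h0
      refine Finsupp.ext fun v => ?_
      cases v with
      | h => exact h0.1.1
      | x i => exact h0.1.2 i
      | d i => exact h0.2 i
    rw [hs]
  · refine le_of_lt (Prod.Lex.toLex_lt_toLex.2 (Or.inl ?_))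
    simpa using Nat.pos_of_ne_zero h0

lemma kmExp_mono {m : ℕ} (s t : HVar m →₀ ℕ) (hst : s ≤ t) :
    @LE.le (KMExp m) _ s t := by
  obtain ⟨u, rfl⟩ := exists_add_of_le hst
  rw [kmExp_le_iff, kmKey_add]
  have hu := kmKey_zero_le u
  have h0 : kmKey (0 : HVar m →₀ ℕ) + kmKey (0 : HVar m →₀ ℕ) = kmKey (0 : HVar m →₀ ℕ) := by
    rw [← kmKey_add, add_zero]
  have h0' : kmKey (0 : HVar m →₀ ℕ) = 0 := by simpa using h0
  rw [h0'] at hu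
  exact le_add_of_nonneg_right hu

instance (m : ℕ) : Finite (HVar m) :=
  Finite.of_surjective
    (fun v : Unit ⊕ Fin m ⊕ Fin m => match v with
      | .inl _ => h
      | .inr (.inl i) => x i
      | .inr (.inr i) => d i)
    (fun v => by
      cases v with
      | h => exact ⟨.inl (), rfl⟩
      | x i => exact ⟨.inr (.inl i), rfl⟩
      | d i => exact ⟨.inr (.inr i), rfl⟩)

instance (m : ℕ) : WellFoundedLT (KMExp m) := by
  have : WellQuasiOrderedLE (KMExp m) :=
    Monotone.wellQuasiOrderedLE_of_wellQuasiOrderedLE_of_surjective (α := HVar m →₀ ℕ) (β := KMExp m) (f := id)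
      (fun s t hst => kmExp_mono s t hst) Function.surjective_id
  infer_instance

/-- The order `≻_{(-1,1)}` on the monomials of `D^(h)`. -/
def kmOrder (m : ℕ) : MonomialOrder (HVar m) where
  syn := KMExp m
  toSyn :=
    { toFun := fun s => s
      invFun := fun s => s
      left_inv := fun _ => rfl
      right_inv := fun _ => rfl
      map_add' := fun _ _ => rfl }
  toSyn_monotone := fun s t hst => kmExp_mono s t hst

/-! ### Gröbner bases in the homogenized Weyl algebra -/

/-- The exponent of the leading monomial of `f` (junk value `0` for `f = 0`). -/
def leadExp {m : ℕ} (f : HWeyl m) : HVar m →₀ ℕ := (kmOrder m).degree (symbol f)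

/-- The leading coefficient of `f`. -/
def leadCoeff {m : ℕ} (f : HWeyl m) : ℂ := (kmOrder m).leadingCoeff (symbol f)

/-- The leading term `in_≺(f) ∈ ℂ[h, x, ξ]`. -/
def inTerm {m : ℕ} (f : HWeyl m) : MvPolynomial (HVar m) ℂ := (kmOrder m).leadingTerm (symbol f)

/-- `f ≼ g`: the leading monomial of `f` is at most that of `g`; the zero element is strictly below
every nonzero element. -/
def LeadLE {m : ℕ} (f g : HWeyl m) : Prop :=
  f = 0 ∨ (f ≠ 0 ∧ g ≠ 0 ∧ (kmOrder m).toSyn (leadExp f) ≤ (kmOrder m).toSyn (leadExp g))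

/-- The S-pair of `f` and `g`: the exponent of the least common multiple of the two leading
monomials is `leadExp f ⊔ leadExp g`. -/
def sPair {m : ℕ} (f g : HWeyl m) : HWeyl m :=
  leadCoeff g • (normalMonomial (leadExp f ⊔ leadExp g - leadExp f) * f) -
    leadCoeff f • (normalMonomial (leadExp f ⊔ leadExp g - leadExp g) * g)

/-- `f` has a standard representation `f = ∑ c_g g` with respect to `G`: the sum is finite and
`c_g g ≼ f` whenever `c_g ≠ 0`. -/
def HasStandardRep {m : ℕ} (G : Set (HWeyl m)) (f : HWeyl m) : Prop :=
  ∃ c : HWeyl m →₀ HWeyl m, (c.support : Set (HWeyl m)) ⊆ G ∧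
    f = ∑ g ∈ c.support, c g * g ∧ ∀ g ∈ c.support, LeadLE (c g * g) f

/-- The S-pair criterion for `G`. -/
def SPairCriterion {m : ℕ} (G : Set (HWeyl m)) : Prop :=
  ∀ f ∈ G, ∀ g ∈ G, HasStandardRep G (sPair f g)

/-- `G` is a Gröbner basis of the left ideal `I` (`Ideal` means left ideal in Mathlib): `G` is
finite, it generates `I`, and the leading terms of `G` generate the initial ideal of `I`. -/
def IsGroebnerBasis {m : ℕ} (G : Set (HWeyl m)) (I : Ideal (HWeyl m)) : Prop :=
  G.Finite ∧ Ideal.span G = I ∧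
    Ideal.span (inTerm '' G) = Ideal.span (inTerm '' (I : Set (HWeyl m)))

/-! ### The operators attached to Lauricella's `F_C` -/

/-- `θ_i = x_i ∂_i`. -/
def theta {m : ℕ} (i : Fin m) : HWeyl m := gen (x i) * gen (d i)

/-- `S_i = θ_i (θ_i + (c_i - 1) h²)`. -/
def opS {m : ℕ} (c : Fin m → ℂ) (i : Fin m) : HWeyl m :=
  theta i * (theta i + (c i - 1) • gen h ^ 2)

/-- `S_{ab} = (∑ θ_i + a h²) (∑ θ_i + b h²)`. -/
def opSab (m : ℕ) (a b : ℂ) : HWeyl m :=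
  ((∑ i, theta i) + a • gen h ^ 2) * ((∑ i, theta i) + b • gen h ^ 2)

/-- `T_i = h S_i - x_i S_{ab}`, the homogenization of
`ℓ_i = θ_i (θ_i + c_i - 1) - x_i (θ + a) (θ + b)`. -/
def opT {m : ℕ} (a b : ℂ) (c : Fin m → ℂ) (i : Fin m) : HWeyl m :=
  gen h * opS c i - gen (x i) * opSab m a b

/-- `T_{ij} = x_j S_i - x_i S_j`, the homogenization of `x_j ℓ_i - x_i ℓ_j`. -/
def opTT {m : ℕ} (c : Fin m → ℂ) (i j : Fin m) : HWeyl m :=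
  gen (x j) * opS c i - gen (x i) * opS c j

/-- `G = {T_1, …, T_m, T_{12}, T_{13}, …, T_{m-1,m}}`. -/
def setG {m : ℕ} (a b : ℂ) (c : Fin m → ℂ) : Set (HWeyl m) :=
  {f | ∃ i, f = opT a b c i} ∪ {f | ∃ i j, i < j ∧ f = opTT c i j}

end LauricellaFC

end

open MvPolynomial

noncomputable section

namespace LauricellaFC

open HVar
open scoped MonomialOrder

/-! ### Comparing exponents -/

/-! With `x_0 = h` and `S_0 = S_{ab}`, the set `G` consists, up to sign, of the 2×2 minors of the
matrix with rows `(x_0, …, x_m)` and `(S_0, …, S_m)`, where `T_i` is the minor on the columns `i,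
0`. Expanding 3×3 determinants with a repeated row gives the basic syzygies `x_k T_{ij} - x_j T_{ik}
= -x_i T_{jk}`, `x_j T_i - h T_{ij} = x_i T_j`, `S_j T_{ik} - S_i T_{jk} = S_k T_{ij}` and `S_j T_i
- S_i T_j = S_{a-1,b-1} T_{ij}`. Noncommutativity costs only the parameter shift in the last one:
`T_{ij}` has degree one for the Euler operator `∑ θ_k`, so moving it across `S_{ab}` lowers `a` and
`b` by one (`opTT_mul_opSab`).

The leading monomials are `h x_i² ξ_i²` for `T_i` (by weight) and `x_j x_i² ξ_i²` for `T_{ij}`, `i <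
j` (by lex). The multipliers in an S-pair involve `x_i² ∂_i²` rather than `S_i`; the two differ by
`c_i h² θ_i`. Each S-pair is therefore a syzygy plus a few correction terms. In every resulting
combination the summands have pairwise distinct leading monomials, so nothing cancels at the top and
the combination is automatically standard (`hasStandardRep_of_leads`).

The passage to a Gröbner basis is Buchberger's argument (`SPairCriterion.isGroebnerBasis`). It works
as in the commutative case because leading exponents add under multiplication (`HasLead.mul`): a
commutator replaces `x_i ∂_i` by the smaller `h²`. -/

lemma kmOrder_lt_iff {m : ℕ} (s t : HVar m →₀ ℕ) :
    s ≺[kmOrder m] t ↔ kmKey s < kmKey t := Iff.rfl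

lemma kmOrder_lt_of_weight {m : ℕ} {s t : HVar m →₀ ℕ}
    (hdeg : s h + ∑ i, s (x i) + ∑ i, s (d i) = t h + ∑ i, t (x i) + ∑ i, t (d i))
    (hw : ∑ i, (s (d i) : ℤ) - ∑ i, (s (x i) : ℤ) <
      ∑ i, (t (d i) : ℤ) - ∑ i, (t (x i) : ℤ)) : s ≺[kmOrder m] t := by
  rw [kmOrder_lt_iff]
  exact Prod.Lex.toLex_lt_toLex.2 (Or.inr ⟨hdeg, Prod.Lex.toLex_lt_toLex.2 (Or.inl hw)⟩)

lemma kmOrder_lt_of_lex {m : ℕ} {s t : HVar m →₀ ℕ}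
    (hdeg : s h + ∑ i, s (x i) + ∑ i, s (d i) = t h + ∑ i, t (x i) + ∑ i, t (d i))
    (hw : ∑ i, (s (d i) : ℤ) - ∑ i, (s (x i) : ℤ) =
      ∑ i, (t (d i) : ℤ) - ∑ i, (t (x i) : ℤ))
    (i : Fin m) (hi : ∀ j < i, s (d j) = t (d j)) (hlt : s (d i) < t (d i)) :
    s ≺[kmOrder m] t := by
  rw [kmOrder_lt_iff]
  exact Prod.Lex.toLex_lt_toLex.2 (Or.inr ⟨hdeg, Prod.Lex.toLex_lt_toLex.2 (Or.inr ⟨hw,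
    Prod.Lex.toLex_lt_toLex.2 (Or.inl ⟨i, hi, hlt⟩)⟩)⟩)

lemma kmOrder_add_lt_add_right {m : ℕ} {s t : HVar m →₀ ℕ} (hst : s ≺[kmOrder m] t)
    (u : HVar m →₀ ℕ) : s + u ≺[kmOrder m] t + u := by
  rw [map_add, map_add]; gcongr

lemma kmOrder_add_lt_add_left {m : ℕ} {s t : HVar m →₀ ℕ} (hst : s ≺[kmOrder m] t)
    (u : HVar m →₀ ℕ) : u + s ≺[kmOrder m] u + t := by
  rw [map_add, map_add]; gcongr

lemma kmOrder_add_lt_add {m : ℕ} {s t u v : HVar m →₀ ℕ} (hst : s ≺[kmOrder m] t)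
    (huv : u ≼[kmOrder m] v) : s + u ≺[kmOrder m] t + v := by
  rw [map_add, map_add]; exact add_lt_add_of_lt_of_le hst huv

/-! ### Elements all of whose monomials lie below a given one -/

lemma symbol_normalOrder {m : ℕ} (p : MvPolynomial (HVar m) ℂ) : symbol (normalOrder m p) = p :=
  (normalOrderEquiv m).symm_apply_apply p

lemma normalOrder_symbol {m : ℕ} (f : HWeyl m) : normalOrder m (symbol f) = f :=
  (normalOrderEquiv m).apply_symm_apply f

lemma symbol_normalMonomial {m : ℕ} (s : HVar m →₀ ℕ) :
    symbol (normalMonomial s) = monomial s 1 := by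
  rw [← normalOrder_monomial, symbol_normalOrder]

lemma symbol_zero {m : ℕ} : symbol (0 : HWeyl m) = 0 := map_zero _

lemma symbol_add {m : ℕ} (f g : HWeyl m) : symbol (f + g) = symbol f + symbol g := map_add _ f g

lemma symbol_sub {m : ℕ} (f g : HWeyl m) : symbol (f - g) = symbol f - symbol g := map_sub _ f g

lemma symbol_smul {m : ℕ} (r : ℂ) (f : HWeyl m) : symbol (r • f) = r • symbol f := map_smul _ r f

lemma symbol_eq_zero {m : ℕ} {f : HWeyl m} : symbol f = 0 ↔ f = 0 :=
  (normalOrderEquiv m).symm.map_eq_zero_iff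

lemma normalOrder_monomial_smul {m : ℕ} (s : HVar m →₀ ℕ) (r : ℂ) :
    normalOrder m (monomial s r) = r • normalMonomial s := by
  rw [← normalOrder_monomial, ← map_smul, smul_monomial, smul_eq_mul, mul_one]

lemma eq_sum_normalMonomial {m : ℕ} (f : HWeyl m) :
    f = ∑ s ∈ (symbol f).support, coeff s (symbol f) • normalMonomial s := by
  conv_lhs => rw [← normalOrder_symbol f, (symbol f).as_sum, map_sum]
  simp only [normalOrder_monomial_smul]

/-- The elements all of whose monomials are smaller than `e`. -/
def lower {m : ℕ} (e : HVar m →₀ ℕ) : Submodule ℂ (HWeyl m) where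
  carrier := {f | ∀ s ∈ (symbol f).support, s ≺[kmOrder m] e}
  zero_mem' := by simp [symbol_zero]
  add_mem' := by
    classical
    intro f g hf hg s hs
    rw [symbol_add] at hs
    rcases Finset.mem_union.1 (support_add hs) with hs | hs
    · exact hf s hs
    · exact hg s hs
  smul_mem' := by
    intro r f hf s hs
    rw [symbol_smul] at hs
    exact hf s (support_smul hs)

lemma lower_mono {m : ℕ} {e e' : HVar m →₀ ℕ} (he : e ≼[kmOrder m] e') :
    lower e ≤ lower e' := fun _ hf s hs => (hf s hs).trans_le he

lemma normalMonomial_mem_lower {m : ℕ} {s e : HVar m →₀ ℕ} (hs : s ≺[kmOrder m] e) :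
    normalMonomial s ∈ lower e := by
  intro t ht
  rw [symbol_normalMonomial] at ht
  rwa [Finset.mem_singleton.1 (support_monomial_subset ht)]

/-- `f` equals `r h^k x^α ∂^β` plus smaller monomials, where `s = (k, α, β)`. -/
def HasLead {m : ℕ} (f : HWeyl m) (s : HVar m →₀ ℕ) (r : ℂ) : Prop :=
  f - r • normalMonomial s ∈ lower s

lemma hasLead_normalMonomial {m : ℕ} (s : HVar m →₀ ℕ) : HasLead (normalMonomial s) s 1 := by
  simp [HasLead]

lemma HasLead.mem_lower {m : ℕ} {f : HWeyl m} {s e : HVar m →₀ ℕ} {r : ℂ} (hf : HasLead f s r)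
    (he : s ≺[kmOrder m] e) : f ∈ lower e := by
  have := add_mem (lower_mono he.le hf) ((lower e).smul_mem r (normalMonomial_mem_lower he))
  rwa [sub_add_cancel] at this

lemma HasLead.add_lower {m : ℕ} {f g : HWeyl m} {s : HVar m →₀ ℕ} {r : ℂ} (hf : HasLead f s r)
    (hg : g ∈ lower s) : HasLead (f + g) s r := by
  have := add_mem hf hg
  rwa [sub_add_eq_add_sub] at this

lemma HasLead.sub_lower {m : ℕ} {f g : HWeyl m} {s : HVar m →₀ ℕ} {r : ℂ} (hf : HasLead f s r)
    (hg : g ∈ lower s) : HasLead (f - g) s r := by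
  rw [sub_eq_add_neg]; exact hf.add_lower (neg_mem hg)

lemma HasLead.smul {m : ℕ} {f : HWeyl m} {s : HVar m →₀ ℕ} {r : ℂ} (hf : HasLead f s r) (r' : ℂ) :
    HasLead (r' • f) s (r' * r) := by
  have := (lower s).smul_mem r' hf
  rwa [smul_sub, smul_smul] at this

lemma HasLead.leading {m : ℕ} {f : HWeyl m} {s : HVar m →₀ ℕ} {r : ℂ} (hf : HasLead f s r)
    (hr : r ≠ 0) : f ≠ 0 ∧ leadExp f = s ∧ leadCoeff f = r := by
  classical
  have hs : coeff s (symbol f) = r := by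
    by_contra hne
    have : s ∈ (symbol (f - r • normalMonomial s)).support := by
      rw [mem_support_iff, symbol_sub, symbol_smul, symbol_normalMonomial]
      simpa [sub_eq_zero] using hne
    exact lt_irrefl _ (hf s this)
  have hle : ∀ t ∈ (symbol f).support, t ≼[kmOrder m] s := by
    intro t ht
    rcases eq_or_ne t s with rfl | hts
    · exact le_rfl
    · refine (hf t ?_).le
      rw [mem_support_iff] at ht ⊢
      rw [symbol_sub, symbol_smul, symbol_normalMonomial]
      simpa [coeff_monomial, hts.symm] using ht
  have h1 : leadExp f = s := by
    refine (kmOrder m).toSyn.injective (le_antisymm ((kmOrder m).degree_le_iff.2 hle) ?_)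
    exact (kmOrder m).le_degree (by rw [mem_support_iff, hs]; exact hr)
  refine ⟨?_, h1, ?_⟩
  · rintro rfl
    rw [symbol_zero, coeff_zero] at hs
    exact hr hs.symm
  · change coeff (leadExp f) (symbol f) = r
    rw [h1, hs]

/-- No nonvanishing hypothesis is needed: for `f = 0` the leading coefficient is `0`. -/
lemma hasLead_leadExp {m : ℕ} (f : HWeyl m) : HasLead f (leadExp f) (leadCoeff f) := by
  classical
  intro t ht
  rw [mem_support_iff, symbol_sub, symbol_smul, symbol_normalMonomial, coeff_sub, coeff_smul,
    coeff_monomial] at ht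
  have hne : leadExp f ≠ t := by
    rintro rfl
    exact ht (by simp [leadCoeff, leadExp, MonomialOrder.leadingCoeff])
  rw [if_neg hne, smul_zero, sub_zero] at ht
  refine lt_of_le_of_ne ((kmOrder m).le_degree (mem_support_iff.2 ht)) fun he => hne ?_
  exact ((kmOrder m).toSyn.injective he).symm

lemma leadCoeff_ne_zero {m : ℕ} {f : HWeyl m} (hf : f ≠ 0) : leadCoeff f ≠ 0 :=
  (kmOrder m).leadingCoeff_ne_zero_iff.2 (symbol_eq_zero.not.2 hf)

lemma leadExp_lt_of_mem_lower {m : ℕ} {f : HWeyl m} (hf : f ≠ 0) {e : HVar m →₀ ℕ}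
    (he : f ∈ lower e) : leadExp f ≺[kmOrder m] e :=
  he _ ((kmOrder m).degree_mem_support (symbol_eq_zero.not.2 hf))

/-! ### Leading monomials of products -/

/-- Total degree and weight agree, so the exponent of `ξ_i` decides. This one comparison makes the
commutator `h²` a lower-order term. -/
lemma two_h_lt_x_d {m : ℕ} (i : Fin m) :
    Finsupp.single h 2 ≺[kmOrder m] Finsupp.single (x i) 1 + Finsupp.single (d i) 1 := by
  classical
  refine kmOrder_lt_of_lex ?_ ?_ i ?_ ?_ <;> simp [Finsupp.single_apply]
  intro j hj
  exact hj.ne'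

lemma hasLead_gen_mul {m : ℕ} (v : HVar m) (t : HVar m →₀ ℕ) :
    HasLead (gen v * normalMonomial t) (Finsupp.single v 1 + t) 1 := by
  classical
  cases v with
  | h => rw [← normalMonomial_h]; exact hasLead_normalMonomial _
  | x i => rw [← normalMonomial_x]; exact hasLead_normalMonomial _
  | d i =>
    -- Read off from `genAct_d`: moving `∂_i` past `x^α` leaves the single commutator term `α_i h²
    -- x^α / x_i`.
    have e : gen (d i) * normalMonomial t = normalMonomial (Finsupp.single (d i) 1 + t) +
        (t (x i) : ℂ) • normalMonomial (Finsupp.single h 2 + (t - Finsupp.single (x i) 1)) := by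
      rw [← normalOrder_monomial t, ← normalOrder_genAct, genAct_d, map_add, X, X, monomial_mul,
        pderiv_monomial, monomial_pow, monomial_mul, normalOrder_monomial_smul,
        normalOrder_monomial_smul]
      simp
    rw [e]
    refine (hasLead_normalMonomial _).add_lower ?_
    -- If `x_i` does not occur, the subtraction of exponents is truncated, but the coefficient
    -- vanishes.
    by_cases ht : t (x i) = 0
    · simp [ht]
    refine (lower _).smul_mem _ (normalMonomial_mem_lower ?_)
    have hle : Finsupp.single (x i) 1 ≤ t := by
      rw [Finsupp.single_le_iff]; omega
    obtain ⟨u, rfl⟩ := exists_add_of_le hle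
    rw [add_tsub_cancel_left]
    have := kmOrder_add_lt_add_right (two_h_lt_x_d i) u
    rwa [add_comm (Finsupp.single (x i) 1), add_assoc] at this

lemma gen_mul_mem_lower {m : ℕ} (v : HVar m) {f : HWeyl m} {e : HVar m →₀ ℕ} (hf : f ∈ lower e) :
    gen v * f ∈ lower (Finsupp.single v 1 + e) := by
  rw [eq_sum_normalMonomial f, Finset.mul_sum]
  refine sum_mem fun s hs => ?_
  rw [mul_smul_comm]
  exact (lower _).smul_mem _
    ((hasLead_gen_mul v s).mem_lower (kmOrder_add_lt_add_left (hf s hs) _))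

lemma HasLead.gen_mul {m : ℕ} (v : HVar m) {f : HWeyl m} {e : HVar m →₀ ℕ} {r : ℂ}
    (hf : HasLead f e r) : HasLead (gen v * f) (Finsupp.single v 1 + e) r := by
  have h1 := ((hasLead_gen_mul v e).smul r).add_lower (gen_mul_mem_lower v hf)
  rwa [mul_sub, mul_smul_comm, add_sub_cancel, mul_one] at h1

/-- A normally ordered monomial is `1` or a generator times a shorter normally ordered monomial. -/
lemma normalMonomial_peel {m : ℕ} (s : HVar m →₀ ℕ) (hs : s ≠ 0) :
    ∃ v t, s = Finsupp.single v 1 + t ∧ t.degree < s.degree ∧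
      normalMonomial s = gen v * normalMonomial t := by
  by_cases h0 : s h = 0
  · by_cases hx : ∀ j, s (x j) = 0
    · have hd : ∃ j, s (d j) ≠ 0 := by
        by_contra! hd
        exact hs (Finsupp.ext fun v => by cases v <;> simp [h0, hx, hd])
      obtain ⟨j, hj⟩ := hd
      obtain ⟨t, hst, -, hlt⟩ := monomial_peel s (d j) hj
      have h1 : t h = 0 := by simpa [h0] using (DFunLike.congr_fun hst h).symm
      have h2 : ∀ i, t (x i) = 0 := fun i => by
        simpa [hx i] using (DFunLike.congr_fun hst (x i)).symm
      exact ⟨d j, t, hst, hlt, by rw [hst, normalMonomial_d j t h1 h2]⟩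
    · push Not at hx
      obtain ⟨j, hj⟩ := hx
      obtain ⟨t, hst, -, hlt⟩ := monomial_peel s (x j) hj
      exact ⟨x j, t, hst, hlt, by rw [hst, normalMonomial_x]⟩
  · obtain ⟨t, hst, -, hlt⟩ := monomial_peel s h h0
    exact ⟨h, t, hst, hlt, by rw [hst, normalMonomial_h]⟩

lemma hasLead_normalMonomial_mul {m : ℕ} (n : ℕ) (t : HVar m →₀ ℕ) :
    ∀ s : HVar m →₀ ℕ, s.degree = n →
      HasLead (normalMonomial s * normalMonomial t) (s + t) 1 := by
  induction n using Nat.strong_induction_on with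
  | _ n ih =>
  intro s hn
  rcases eq_or_ne s 0 with rfl | hs
  · rw [normalMonomial_zero, one_mul, zero_add]; exact hasLead_normalMonomial t
  · obtain ⟨v, u, rfl, hlt, e⟩ := normalMonomial_peel s hs
    rw [e, mul_assoc, add_assoc]
    exact (ih _ (hn ▸ hlt) u rfl).gen_mul v

lemma mul_mem_lower {m : ℕ} {f g : HWeyl m} {e : HVar m →₀ ℕ}
    (hfg : ∀ s ∈ (symbol f).support, ∀ t ∈ (symbol g).support, s + t ≺[kmOrder m] e) :
    f * g ∈ lower e := by
  rw [eq_sum_normalMonomial f, eq_sum_normalMonomial g, Finset.sum_mul_sum]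
  refine sum_mem fun s hs => sum_mem fun t ht => ?_
  rw [smul_mul_smul_comm]
  exact (lower _).smul_mem _ ((hasLead_normalMonomial_mul _ t s rfl).mem_lower (hfg s hs t ht))

/-- Split off the two leading terms; each of the three products involving a lower part stays below
`s + t`. The coefficients are allowed to vanish. -/
lemma HasLead.mul {m : ℕ} {f g : HWeyl m} {s t : HVar m →₀ ℕ} {r r' : ℂ} (hf : HasLead f s r)
    (hg : HasLead g t r') : HasLead (f * g) (s + t) (r * r') := by
  obtain ⟨f', hf', rfl⟩ : ∃ f' ∈ lower s, f = r • normalMonomial s + f' := ⟨_, hf, by abel⟩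
  obtain ⟨g', hg', rfl⟩ : ∃ g' ∈ lower t, g = r' • normalMonomial t + g' := ⟨_, hg, by abel⟩
  have hs : ∀ (s : HVar m →₀ ℕ) (r : ℂ), ∀ u ∈ (symbol (r • normalMonomial s)).support, u = s := by
    intro s r u hu
    rw [symbol_smul, symbol_normalMonomial] at hu
    exact Finset.mem_singleton.1 (support_monomial_subset (support_smul hu))
  rw [add_mul, mul_add, mul_add, smul_mul_smul_comm, add_assoc]
  have h1 := (hasLead_normalMonomial_mul _ t s rfl).smul (r * r')
  rw [mul_one] at h1
  refine h1.add_lower (add_mem (mul_mem_lower fun a ha b hb => ?_)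
    (add_mem (mul_mem_lower fun a ha b hb => ?_) (mul_mem_lower fun a ha b hb => ?_)))
  · rw [hs _ _ _ ha]; exact kmOrder_add_lt_add_left (hg' b hb) _
  · rw [hs _ _ _ hb]; exact kmOrder_add_lt_add_right (hf' a ha) _
  · exact kmOrder_add_lt_add (hf' a ha) (hg' b hb).le

lemma hasLead_gen {m : ℕ} (v : HVar m) : HasLead (gen v) (Finsupp.single v 1) 1 := by
  simpa [normalMonomial_zero] using hasLead_gen_mul v 0

lemma leadExp_mul {m : ℕ} {f g : HWeyl m} (hf : f ≠ 0) (hg : g ≠ 0) :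
    f * g ≠ 0 ∧ leadExp (f * g) = leadExp f + leadExp g := by
  have hfg := ((hasLead_leadExp f).mul (hasLead_leadExp g)).leading
    (mul_ne_zero (leadCoeff_ne_zero hf) (leadCoeff_ne_zero hg))
  exact ⟨hfg.1, hfg.2.1⟩

/-! ### Standard representations -/

lemma leadLE_zero {m : ℕ} (f : HWeyl m) : LeadLE 0 f := Or.inl rfl

lemma LeadLE.add {m : ℕ} {p q f : HWeyl m} (hp : LeadLE p f) (hq : LeadLE q f) :
    LeadLE (p + q) f := by
  rcases hp with rfl | ⟨-, hf, hp⟩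
  · rwa [zero_add]
  rcases hq with rfl | ⟨-, -, hq⟩
  · rw [add_zero]
    rcases eq_or_ne p 0 with h0 | h0
    · exact Or.inl h0
    · exact Or.inr ⟨h0, hf, hp⟩
  rcases eq_or_ne (p + q) 0 with h0 | h0
  · exact Or.inl h0
  refine Or.inr ⟨h0, hf, ?_⟩
  rw [leadExp, symbol_add]
  exact (kmOrder m).degree_add_le.trans (max_le hp hq)

lemma leadLE_sum {m : ℕ} {ι : Type*} (S : Finset ι) (p : ι → HWeyl m) (f : HWeyl m)
    (hp : ∀ i ∈ S, LeadLE (p i) f) : LeadLE (∑ i ∈ S, p i) f :=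
  Finset.sum_induction p (fun q => LeadLE q f) (fun _ _ => LeadLE.add) (leadLE_zero f) hp

/-- The `g i` may repeat, whereas a standard representation has one cofactor per element of `G`.
Collecting cofactors is harmless because `LeadLE` to a fixed element is closed under sums. -/
lemma hasStandardRep_of_sum {m : ℕ} {G : Set (HWeyl m)} {ι : Type*} (S : Finset ι)
    (q g : ι → HWeyl m) (hg : ∀ i ∈ S, g i ∈ G)
    (hle : ∀ i ∈ S, LeadLE (q i * g i) (∑ i ∈ S, q i * g i)) :
    HasStandardRep G (∑ i ∈ S, q i * g i) := by
  classical
  refine ⟨∑ i ∈ S, Finsupp.single (g i) (q i), ?_, ?_, ?_⟩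
  · intro p hp
    obtain ⟨i, hi, hpi⟩ := Finset.mem_biUnion.1 (Finsupp.support_finsetSum hp)
    rw [Finset.mem_singleton.1 (Finsupp.support_single_subset hpi)]
    exact hg i hi
  · change _ = Finsupp.sum (∑ i ∈ S, Finsupp.single (g i) (q i)) fun p r => r * p
    rw [← Finsupp.sum_finsetSum_index (fun p => zero_mul p) (fun p r r' => add_mul r r' p)]
    simp
  · intro p _
    rw [Finsupp.finsetSum_apply, Finset.sum_mul]
    refine leadLE_sum _ _ _ fun i hi => ?_
    rw [Finsupp.single_apply]
    split_ifs with hp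
    · subst hp; exact hle i hi
    · rw [zero_mul]; exact leadLE_zero _

/-- A sum of elements whose leading monomials are pairwise distinct has no cancellation of
leading monomials. -/
lemma leadLE_sum_of_injOn {m : ℕ} {ι : Type*} (S : Finset ι) (p : ι → HWeyl m)
    (hp : ∀ i ∈ S, ∀ j ∈ S, p i ≠ 0 → p j ≠ 0 → leadExp (p i) = leadExp (p j) → i = j) :
    ∀ i ∈ S, LeadLE (p i) (∑ j ∈ S, p j) := by
  classical
  intro i hi
  by_cases h0 : p i = 0
  · exact Or.inl h0
  -- The nonzero summand with the largest leading monomial is unique, so its leading coefficient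
  -- survives in the sum.
  obtain ⟨k, hk, hmax⟩ := (S.filter fun j => p j ≠ 0).exists_max_image
    (fun j => (kmOrder m).toSyn (leadExp (p j))) ⟨i, by simp [hi, h0]⟩
  rw [Finset.mem_filter] at hk
  have hc : coeff (leadExp (p k)) (symbol (∑ j ∈ S, p j)) = leadCoeff (p k) := by
    have : symbol (∑ j ∈ S, p j) = ∑ j ∈ S, symbol (p j) := map_sum _ _ _
    rw [this, coeff_sum, Finset.sum_eq_single_of_mem k hk.1]
    · rfl
    · intro j hj hjk
      by_cases hj0 : p j = 0
      · rw [hj0, symbol_zero, coeff_zero]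
      · refine (kmOrder m).coeff_eq_zero_of_lt (lt_of_le_of_ne
          (hmax j (Finset.mem_filter.2 ⟨hj, hj0⟩)) fun he => hjk ?_)
        exact hp j hj k hk.1 hj0 hk.2 ((kmOrder m).toSyn.injective he)
  have hc0 : coeff (leadExp (p k)) (symbol (∑ j ∈ S, p j)) ≠ 0 := by
    rw [hc]; exact leadCoeff_ne_zero hk.2
  refine Or.inr ⟨h0, ?_, (hmax i (Finset.mem_filter.2 ⟨hi, h0⟩)).trans
    ((kmOrder m).le_degree (mem_support_iff.2 hc0))⟩
  intro hs
  rw [hs, symbol_zero, coeff_zero] at hc0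
  exact hc0 rfl

/-- A combination of elements of `G` whose summands have known, pairwise distinct leading
monomials is a standard representation. -/
lemma hasStandardRep_of_leads {m : ℕ} {G : Set (HWeyl m)} {n : ℕ} (r : Fin n → ℂ)
    (p g : Fin n → HWeyl m) (s t : Fin n → HVar m →₀ ℕ) (hg : ∀ i, g i ∈ G)
    (hp : ∀ i, HasLead (p i) (s i) 1) (hglead : ∀ i, HasLead (g i) (t i) 1)
    (hst : ∀ i j, s i + t i = s j + t j → i = j) :
    HasStandardRep G (∑ i, r i • (p i * g i)) := by
  -- A coefficient `r i` may vanish for special parameters; only nonzero summands have to be told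
  -- apart.
  have key : ∀ i, r i • p i * g i ≠ 0 → leadExp (r i • p i * g i) = s i + t i := by
    intro i hi
    rw [smul_mul_assoc] at hi ⊢
    have hr : r i ≠ 0 := by
      intro hr
      rw [hr, zero_smul] at hi
      exact hi rfl
    exact ((((hp i).mul (hglead i)).smul (r i)).leading (by simpa using hr)).2.1
  simp only [← smul_mul_assoc]
  refine hasStandardRep_of_sum _ (fun i => r i • p i) g (fun i _ => hg i)
    (leadLE_sum_of_injOn _ _ fun i _ j _ hi hj hij => hst i j ?_)
  rw [← key i hi, ← key j hj, hij]

/-- The multiplier exponents `s ⊔ t - s` and `s ⊔ t - t` are the truncated differences `t - s` and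
`s - t`, which can be checked variable by variable. -/
lemma hasStandardRep_sPair {m : ℕ} {G : Set (HWeyl m)} {f g : HWeyl m}
    {s t w w' : HVar m →₀ ℕ} (hf : HasLead f s 1) (hg : HasLead g t 1)
    (hw : ∀ v, w v = t v - s v) (hw' : ∀ v, w' v = s v - t v)
    (h : HasStandardRep G (normalMonomial w * f - normalMonomial w' * g)) :
    HasStandardRep G (sPair f g) := by
  obtain ⟨-, hf1, hf2⟩ := hf.leading one_ne_zero
  obtain ⟨-, hg1, hg2⟩ := hg.leading one_ne_zero
  have e : s ⊔ t - s = w := by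
    ext v
    rw [hw, Finsupp.tsub_apply, Finsupp.sup_apply]
    omega
  have e' : s ⊔ t - t = w' := by
    ext v
    rw [hw', Finsupp.tsub_apply, Finsupp.sup_apply]
    omega
  rw [sPair, hf1, hf2, hg1, hg2, e, e', one_smul, one_smul]
  exact h

lemma hasStandardRep_zero {m : ℕ} (G : Set (HWeyl m)) : HasStandardRep G (0 : HWeyl m) :=
  ⟨0, by simp, by simp, by simp⟩

lemma HasStandardRep.neg {m : ℕ} {G : Set (HWeyl m)} {f : HWeyl m} (hf : HasStandardRep G f) :
    HasStandardRep G (-f) := by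
  obtain ⟨c, hc, e, hle⟩ := hf
  have hle' : ∀ p, LeadLE p f → LeadLE (-p) (-f) := by
    have hneg : ∀ p : HWeyl m, leadExp (-p) = leadExp p := fun p => by
      have : symbol (-p) = -symbol p := map_neg _ _
      rw [leadExp, this, MonomialOrder.degree_neg, leadExp]
    rintro p (rfl | ⟨h1, h2, h3⟩)
    · rw [neg_zero]; exact leadLE_zero _
    · exact Or.inr ⟨neg_ne_zero.2 h1, neg_ne_zero.2 h2, by rwa [hneg, hneg]⟩
  have e' : -f = ∑ g ∈ c.support, (-c g) * g := by
    rw [e, ← Finset.sum_neg_distrib]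
    exact Finset.sum_congr rfl fun g _ => (neg_mul (c g) g).symm
  rw [e']
  refine hasStandardRep_of_sum _ (fun g => -c g) id (fun g hg => hc hg) fun g hg => ?_
  have := hle' _ (hle g hg)
  rw [e', show -(c g * g) = -c g * g from (neg_mul (c g) g).symm] at this
  exact this

lemma sPair_self {m : ℕ} (f : HWeyl m) : sPair f f = 0 := sub_self _

lemma sPair_swap {m : ℕ} (f g : HWeyl m) : sPair g f = -sPair f g := by
  rw [sPair, sPair, sup_comm, neg_sub]

/-! ### Buchberger's criterion -/

/-- The span of the products `h^k x^α ∂^β g`, `g ∈ G`, whose leading exponent lies in `E`. -/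
def repSpan {m : ℕ} (G : Set (HWeyl m)) (E : Set (HVar m →₀ ℕ)) : Submodule ℂ (HWeyl m) :=
  Submodule.span ℂ {p | ∃ g ∈ G, g ≠ 0 ∧ ∃ s, s + leadExp g ∈ E ∧ p = normalMonomial s * g}

lemma repSpan_mono {m : ℕ} (G : Set (HWeyl m)) {E E' : Set (HVar m →₀ ℕ)} (hE : E ⊆ E') :
    repSpan G E ≤ repSpan G E' :=
  Submodule.span_mono fun _ ⟨g, hg, h0, s, hs, hp⟩ => ⟨g, hg, h0, s, hE hs, hp⟩

lemma normalMonomial_mul_mem_repSpan {m : ℕ} {G : Set (HWeyl m)} {E : Set (HVar m →₀ ℕ)}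
    {g : HWeyl m} (hg : g ∈ G) {s : HVar m →₀ ℕ} (hs : s + leadExp g ∈ E) :
    normalMonomial s * g ∈ repSpan G E := by
  by_cases h0 : g = 0
  · rw [h0, mul_zero]; exact zero_mem _
  · exact Submodule.subset_span ⟨g, hg, h0, s, hs, rfl⟩

lemma mul_mem_repSpan {m : ℕ} {G : Set (HWeyl m)} {E : Set (HVar m →₀ ℕ)} {g : HWeyl m}
    (hg : g ∈ G) (q : HWeyl m) (hq : ∀ s ∈ (symbol q).support, s + leadExp g ∈ E) :
    q * g ∈ repSpan G E := by
  rw [eq_sum_normalMonomial q, Finset.sum_mul]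
  refine sum_mem fun s hs => ?_
  rw [smul_mul_assoc]
  exact Submodule.smul_mem _ _ (normalMonomial_mul_mem_repSpan hg (hq s hs))

lemma repSpan_lt_le_lower {m : ℕ} (G : Set (HWeyl m)) (e : HVar m →₀ ℕ) :
    repSpan G {s | s ≺[kmOrder m] e} ≤ lower e := by
  rw [repSpan, Submodule.span_le]
  rintro p ⟨g, -, -, s, hs, rfl⟩
  exact ((hasLead_normalMonomial s).mul (hasLead_leadExp g)).mem_lower hs

/-- A finite combination has a largest exponent among its terms. With `E` the exponents below `e`,
this turns a strict bound into a weak bound by a strictly smaller exponent, as the descent requires.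
-/
lemma exists_mem_repSpan_le {m : ℕ} {G : Set (HWeyl m)} {E : Set (HVar m →₀ ℕ)} {f : HWeyl m}
    (hf : f ∈ repSpan G E) : f = 0 ∨ ∃ e ∈ E, f ∈ repSpan G {s | s ≼[kmOrder m] e} := by
  induction hf using Submodule.span_induction with
  | mem p hp =>
    obtain ⟨g, hg, -, s, hs, rfl⟩ := hp
    exact Or.inr ⟨_, hs, normalMonomial_mul_mem_repSpan hg (le_refl ((kmOrder m).toSyn _))⟩
  | zero => exact Or.inl rfl
  | add p q _ _ hp hq =>
    rcases hp with rfl | ⟨e, he, hp⟩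
    · rwa [zero_add]
    rcases hq with rfl | ⟨e', he', hq⟩
    · rw [add_zero]; exact Or.inr ⟨e, he, hp⟩
    rcases le_total ((kmOrder m).toSyn e) ((kmOrder m).toSyn e') with hle | hle
    · exact Or.inr ⟨e', he', add_mem (repSpan_mono G (fun s hs => le_trans hs hle) hp) hq⟩
    · exact Or.inr ⟨e, he, add_mem hp (repSpan_mono G (fun s hs => le_trans hs hle) hq)⟩
  | smul r p _ hp =>
    rcases hp with rfl | ⟨e, he, hp⟩
    · exact Or.inl (smul_zero r)
    · exact Or.inr ⟨e, he, Submodule.smul_mem _ _ hp⟩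

/-- The products in a standard representation of `f` lead no higher than `f`, hence below `e`;
multiplication by a monomial shifts all these exponents by `w`. -/
lemma HasStandardRep.mul_mem_repSpan {m : ℕ} {G : Set (HWeyl m)} {f : HWeyl m}
    (hf : HasStandardRep G f) {e : HVar m →₀ ℕ} (he : f ∈ lower e) (w : HVar m →₀ ℕ) :
    normalMonomial w * f ∈ repSpan G {s | s ≺[kmOrder m] w + e} := by
  obtain ⟨c, hc, hsum, hle⟩ := hf
  rw [hsum, Finset.mul_sum]
  refine sum_mem fun g hg => ?_
  rw [← mul_assoc]
  by_cases h0 : g = 0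
  · rw [h0, mul_zero]; exact zero_mem _
  have hcg : c g ≠ 0 := Finsupp.mem_support_iff.1 hg
  have hlead := leadExp_mul hcg h0
  rcases hle g hg with hz | ⟨-, hf0, hlt⟩
  · exact absurd hz hlead.1
  have hlt' : leadExp (c g) + leadExp g ≺[kmOrder m] e := by
    rw [← hlead.2]; exact hlt.trans_lt (leadExp_lt_of_mem_lower hf0 he)
  have hw : normalMonomial w * c g ≠ 0 ∧
      leadExp (normalMonomial w * c g) = w + leadExp (c g) := by
    have := ((hasLead_normalMonomial w).mul (hasLead_leadExp (c g))).leading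
      (by simpa using leadCoeff_ne_zero hcg)
    exact ⟨this.1, this.2.1⟩
  refine LauricellaFC.mul_mem_repSpan (hc hg) _ fun s hs => ?_
  have hs' : s ≼[kmOrder m] w + leadExp (c g) := by
    rw [← hw.2]; exact (kmOrder m).le_degree hs
  have h1 := kmOrder_add_lt_add_left hlt' w
  rw [← add_assoc] at h1
  refine lt_of_le_of_lt ?_ h1
  rw [map_add, map_add (kmOrder m).toSyn (w + leadExp (c g))]
  gcongr

/-- Both halves have the same leading exponent and the same leading coefficient, which cancel. -/
lemma sPair_mem_lower {m : ℕ} (f g : HWeyl m) : sPair f g ∈ lower (leadExp f ⊔ leadExp g) := by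
  have hf := ((hasLead_normalMonomial (leadExp f ⊔ leadExp g - leadExp f)).mul
    (hasLead_leadExp f)).smul (leadCoeff g)
  have hg := ((hasLead_normalMonomial (leadExp f ⊔ leadExp g - leadExp g)).mul
    (hasLead_leadExp g)).smul (leadCoeff f)
  rw [tsub_add_cancel_of_le le_sup_left] at hf
  rw [tsub_add_cancel_of_le le_sup_right] at hg
  have := sub_mem hf hg
  rwa [one_mul, one_mul, mul_comm (leadCoeff g), sub_sub_sub_cancel_right] at this

/-- The common leading exponent is a multiple of the least common multiple, so the difference is a
monomial times the S-pair, up to lower products. -/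
lemma SPairCriterion.sub_mem_repSpan {m : ℕ} {G : Set (HWeyl m)} (hG : SPairCriterion G)
    {f g : HWeyl m} (hf : f ∈ G) (hg : g ∈ G) {s t : HVar m →₀ ℕ}
    (hst : s + leadExp f = t + leadExp g) :
    leadCoeff g • (normalMonomial s * f) - leadCoeff f • (normalMonomial t * g) ∈
      repSpan G {u | u ≺[kmOrder m] s + leadExp f} := by
  obtain ⟨w, hw⟩ : ∃ w, s + leadExp f = w + (leadExp f ⊔ leadExp g) := by
    obtain ⟨w, hw⟩ := exists_add_of_le
      (sup_le (le_add_self : leadExp f ≤ s + leadExp f) (hst.ge.trans' le_add_self))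
    exact ⟨w, hw.trans (add_comm _ _)⟩
  -- The product of the normal monomials with exponents `w` and `u - leadExp f` is not the one with
  -- exponent `s`, but the difference consists of lower monomials.
  have key : ∀ (s : HVar m →₀ ℕ) (f : HWeyl m) (u e : HVar m →₀ ℕ), f ∈ G → leadExp f ≤ u →
      s + leadExp f = w + u → e = s + leadExp f →
      normalMonomial s * f - normalMonomial w * (normalMonomial (u - leadExp f) * f) ∈
        repSpan G {v | v ≺[kmOrder m] e} := by
    intro s f u e hf hu hs he
    have hs' : s = w + (u - leadExp f) := by
      rw [← add_left_inj (leadExp f), hs, add_assoc, tsub_add_cancel_of_le hu]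
    rw [← mul_assoc, ← sub_mul, he]
    refine mul_mem_repSpan hf _ fun v hv => kmOrder_add_lt_add_right ?_ _
    have h1 := (hasLead_normalMonomial_mul _ (u - leadExp f) w rfl)
    rw [← hs', HasLead, one_smul] at h1
    have h2 := neg_mem h1
    rw [neg_sub] at h2
    exact h2 v hv
  have h1 := key s f _ _ hf le_sup_left hw rfl
  have h2 := key t g _ _ hg le_sup_right (hst ▸ hw) hst
  have h3 := (hG f hf g hg).mul_mem_repSpan (sPair_mem_lower f g) w
  rw [← hw] at h3
  have := add_mem (sub_mem (Submodule.smul_mem _ (leadCoeff g) h1)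
    (Submodule.smul_mem _ (leadCoeff f) h2)) h3
  convert this using 1
  rw [sPair, mul_sub, mul_smul_comm, mul_smul_comm, smul_sub, smul_sub]
  abel

/-- Modulo the products below `e`, all products with leading exponent exactly `e` are proportional
by `SPairCriterion.sub_mem_repSpan`. The quotient is thus at most one-dimensional, spanned by any
one of them. -/
lemma SPairCriterion.mem_repSpan_le {m : ℕ} {G : Set (HWeyl m)} (hG : SPairCriterion G)
    {f : HWeyl m} {e : HVar m →₀ ℕ} (hf : f ∈ repSpan G {s | s ≼[kmOrder m] e}) :
    f ∈ repSpan G {s | s ≺[kmOrder m] e} ∨ ∃ g ∈ G, g ≠ 0 ∧ ∃ s, s + leadExp g = e ∧ ∃ r : ℂ,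
      r ≠ 0 ∧ f - r • (normalMonomial s * g) ∈ repSpan G {s | s ≺[kmOrder m] e} := by
  by_cases hex : ∃ g ∈ G, g ≠ 0 ∧ ∃ s, s + leadExp g = e
  · obtain ⟨g, hg, h0, s, hs⟩ := hex
    have hle : repSpan G {s | s ≼[kmOrder m] e} ≤ repSpan G {s | s ≺[kmOrder m] e} ⊔
        Submodule.span ℂ {normalMonomial s * g} := by
      rw [repSpan, Submodule.span_le]
      rintro p ⟨g', hg', h0', t, ht, rfl⟩
      rcases lt_or_eq_of_le (show t + leadExp g' ≼[kmOrder m] e from ht) with hlt | heq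
      · exact Submodule.mem_sup_left (normalMonomial_mul_mem_repSpan hg' hlt)
      · have heq' : t + leadExp g' = e := (kmOrder m).toSyn.injective heq
        have hd := hG.sub_mem_repSpan hg' hg (heq'.trans hs.symm)
        rw [heq'] at hd
        have h1 := add_mem (Submodule.mem_sup_left hd) (Submodule.mem_sup_right
          (Submodule.smul_mem _ (leadCoeff g') (Submodule.mem_span_singleton_self (normalMonomial s * g))))
        rw [sub_add_cancel] at h1
        exact (Submodule.smul_mem_iff _ (leadCoeff_ne_zero h0)).1 h1
    obtain ⟨p, hp, q, hq, rfl⟩ := Submodule.mem_sup.1 (hle hf)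
    obtain ⟨r, rfl⟩ := Submodule.mem_span_singleton.1 hq
    rcases eq_or_ne r 0 with rfl | hr
    · left; rwa [zero_smul, add_zero]
    · exact Or.inr ⟨g, hg, h0, s, hs, r, hr, by rwa [add_sub_cancel_right]⟩
  · left
    have hle : repSpan G {s | s ≼[kmOrder m] e} ≤ repSpan G {s | s ≺[kmOrder m] e} := by
      rw [repSpan, Submodule.span_le]
      rintro p ⟨g, hg, h0, t, ht, rfl⟩
      refine normalMonomial_mul_mem_repSpan hg (lt_of_le_of_ne (α := (kmOrder m).syn) ht fun heq => hex ?_)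
      exact ⟨g, hg, h0, t, (kmOrder m).toSyn.injective heq⟩
    exact hle hf

/-- Well-founded descent on the bound `e`: either every product can be pushed below `e`, or a single
product at `e` remains with nonzero coefficient and must supply the leading monomial of `f`. -/
lemma SPairCriterion.exists_leadExp_eq {m : ℕ} {G : Set (HWeyl m)} (hG : SPairCriterion G)
    {f : HWeyl m} (h0 : f ≠ 0) (E : (kmOrder m).syn) :
    ∀ e : HVar m →₀ ℕ, (kmOrder m).toSyn e = E → f ∈ repSpan G {s | s ≼[kmOrder m] e} →
      ∃ g ∈ G, g ≠ 0 ∧ ∃ s, s + leadExp g = leadExp f := by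
  induction E using WellFoundedLT.induction with
  | _ E ih =>
  rintro e rfl hf
  rcases hG.mem_repSpan_le hf with hf | ⟨g, hg, hg0, s, hs, r, hr, hf⟩
  · obtain ⟨e', he', hf'⟩ := (exists_mem_repSpan_le hf).resolve_left h0
    exact ih _ he' e' rfl hf'
  · refine ⟨g, hg, hg0, s, ?_⟩
    have h1 := ((hasLead_normalMonomial s).mul (hasLead_leadExp g)).smul r
    rw [hs] at h1
    have h2 := h1.add_lower (repSpan_lt_le_lower G e hf)
    rw [add_sub_cancel] at h2
    rw [hs, (h2.leading (by simp [hr, leadCoeff_ne_zero hg0])).2.1]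

lemma mem_repSpan_univ {m : ℕ} {G : Set (HWeyl m)} {f : HWeyl m} (hf : f ∈ Ideal.span G) :
    f ∈ repSpan G Set.univ := by
  induction hf using Submodule.span_induction with
  | mem g hg => simpa using mul_mem_repSpan hg 1 (fun s _ => Set.mem_univ (s + leadExp g))
  | zero => exact zero_mem _
  | add p q _ _ hp hq => exact add_mem hp hq
  | smul a p _ hp =>
    -- `repSpan` is only a `ℂ`-subspace, so stability under left multiplication is checked on its
    -- spanning products.
    clear * - hp
    induction hp using Submodule.span_induction with
    | mem p hp =>
      obtain ⟨g, hg, -, s, -, rfl⟩ := hp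
      rw [smul_eq_mul, ← mul_assoc]
      exact mul_mem_repSpan hg _ fun _ _ => Set.mem_univ _
    | zero => rw [smul_zero]; exact zero_mem _
    | add p q _ _ hp hq => rw [smul_add]; exact add_mem hp hq
    | smul r p _ hp => rw [smul_comm]; exact Submodule.smul_mem _ _ hp

/-- **Buchberger's criterion** in the homogenized Weyl algebra. -/
theorem SPairCriterion.isGroebnerBasis {m : ℕ} {G : Set (HWeyl m)} (hG : SPairCriterion G)
    (hfin : G.Finite) : IsGroebnerBasis G (Ideal.span G) := by
  refine ⟨hfin, rfl, le_antisymm (Ideal.span_mono (Set.image_mono Ideal.subset_span)) ?_⟩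
  rw [Ideal.span_le]
  rintro _ ⟨f, hf, rfl⟩
  rcases eq_or_ne f 0 with rfl | h0
  · rw [inTerm, symbol_zero, MonomialOrder.leadingTerm_zero]; exact zero_mem _
  obtain ⟨e, -, he⟩ := (exists_mem_repSpan_le (mem_repSpan_univ hf)).resolve_left h0
  obtain ⟨g, hg, hg0, s, hs⟩ := hG.exists_leadExp_eq h0 _ e rfl he
  have hin : inTerm f = monomial s (leadCoeff f / leadCoeff g) * inTerm g := by
    change monomial (leadExp f) (leadCoeff f) = _ * monomial (leadExp g) (leadCoeff g)
    rw [monomial_mul, hs, div_mul_cancel₀ _ (leadCoeff_ne_zero hg0)]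
  rw [hin]
  exact Ideal.mul_mem_left _ _ (Ideal.subset_span ⟨g, hg, rfl⟩)

/-! ### Commutation rules -/

lemma smul_eq_smul_add {m : ℕ} (r s : ℂ) (f : HWeyl m) : r • f = s • f + (r - s) • f := by
  rw [← add_smul, add_sub_cancel]

lemma commute_h {m : ℕ} (f : HWeyl m) : Commute (gen h) f := by
  obtain ⟨f, rfl⟩ := RingQuot.mkAlgHom_surjective ℂ (HRel m) f
  induction f using FreeAlgebra.induction with
  | grade0 r => rw [AlgHom.commutes]; exact Algebra.commute_algebraMap_right r _
  | grade1 v => exact h_mul v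
  | mul f g hf hg => rw [map_mul]; exact hf.mul_right hg
  | add f g hf hg => rw [map_add]; exact hf.add_right hg

lemma commute_x_x {m : ℕ} (i j : Fin m) : Commute (gen (x i)) (gen (x j)) := x_mul_x i j

lemma commute_d_x {m : ℕ} {i j : Fin m} (hij : i ≠ j) : Commute (gen (d i)) (gen (x j)) := by
  have := d_mul_x i j
  rwa [if_neg hij, add_zero] at this

lemma commute_smul_h_sq {m : ℕ} (r : ℂ) (f : HWeyl m) : Commute (r • gen h ^ 2) f :=
  ((commute_h f).pow_left 2).smul_left r

lemma commute_x_theta {m : ℕ} {i j : Fin m} (hij : i ≠ j) : Commute (gen (x i)) (theta j) :=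
  (commute_x_x i j).mul_right (commute_d_x hij.symm).symm

lemma commute_d_theta {m : ℕ} {i j : Fin m} (hij : i ≠ j) : Commute (gen (d i)) (theta j) :=
  (commute_d_x hij).mul_right (d_mul_d i j)

lemma commute_theta {m : ℕ} (i j : Fin m) : Commute (theta i) (theta j) := by
  rcases eq_or_ne i j with rfl | hij
  · exact Commute.refl _
  · exact (commute_x_theta hij).mul_left (commute_d_theta hij)

lemma commute_opS {m : ℕ} (c : Fin m → ℂ) {f : HWeyl m} {i : Fin m} (hf : Commute f (theta i)) :
    Commute f (opS c i) :=
  hf.mul_right (hf.add_right (commute_smul_h_sq _ _).symm)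

lemma commute_x_opS {m : ℕ} (c : Fin m → ℂ) {i j : Fin m} (hij : i ≠ j) :
    Commute (gen (x i)) (opS c j) := commute_opS c (commute_x_theta hij)

lemma commute_opS_opS {m : ℕ} (c : Fin m → ℂ) (i j : Fin m) : Commute (opS c i) (opS c j) :=
  commute_opS c (commute_opS c (commute_theta j i)).symm

lemma theta_mul_x_self {m : ℕ} (i : Fin m) :
    theta i * gen (x i) = gen (x i) * (theta i + gen h ^ 2) := by
  rw [theta, mul_assoc, d_mul_x, if_pos rfl]

lemma sum_theta_mul_x {m : ℕ} (i : Fin m) :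
    (∑ j, theta j) * gen (x i) = gen (x i) * (∑ j, theta j + gen h ^ 2) := by
  rw [← Finset.add_sum_erase Finset.univ _ (Finset.mem_univ i), add_mul, theta_mul_x_self,
    add_right_comm, mul_add _ _ (∑ j ∈ _, _)]
  congr 1
  refine (Commute.sum_right _ _ _ fun j hj => ?_).eq.symm
  exact commute_x_theta (Finset.ne_of_mem_erase hj).symm

/-- Each `S_i` commutes with the Euler operator, and each `x_j` raises its value by `h²`. -/
lemma sum_theta_mul_opTT {m : ℕ} (c : Fin m → ℂ) (i j : Fin m) :
    (∑ k, theta k) * opTT c i j = opTT c i j * (∑ k, theta k + gen h ^ 2) := by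
  have hS : ∀ i, Commute (∑ k, theta k + gen h ^ 2) (opS c i) := fun i =>
    (Commute.sum_left _ _ _ fun k _ => commute_opS c (commute_theta k i)).add_left
      ((commute_h _).pow_left 2)
  rw [opTT, mul_sub, ← mul_assoc, sum_theta_mul_x, mul_assoc, (hS i).eq, ← mul_assoc,
    ← mul_assoc _ _ (opS c j), sum_theta_mul_x, mul_assoc _ _ (opS c j), (hS j).eq, ← mul_assoc,
    sub_mul]

lemma opTT_mul_opSab {m : ℕ} (a b : ℂ) (c : Fin m → ℂ) (i j : Fin m) :
    opTT c i j * opSab m a b = opSab m (a - 1) (b - 1) * opTT c i j := by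
  have key : ∀ r : ℂ, opTT c i j * (∑ k, theta k + r • gen h ^ 2) =
      (∑ k, theta k + (r - 1) • gen h ^ 2) * opTT c i j := by
    intro r
    rw [add_mul, sum_theta_mul_opTT, (commute_smul_h_sq _ _).eq, ← mul_add, smul_eq_smul_add r 1,
      one_smul, add_assoc]
  rw [opSab, opSab, ← mul_assoc, key, mul_assoc, key, mul_assoc]

/-- Normal ordering gives `θ_i² = x_i² ∂_i² + h² θ_i`, which turns `c_i - 1` into `c_i`. -/
lemma opS_eq {m : ℕ} (c : Fin m → ℂ) (i : Fin m) :
    opS c i = gen (x i) * gen (x i) * gen (d i) * gen (d i) + c i • (gen h ^ 2 * theta i) := by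
  have e : theta i * theta i =
      gen (x i) * gen (x i) * gen (d i) * gen (d i) + gen h ^ 2 * theta i := by
    conv_lhs => rw [show (theta i : HWeyl m) * theta i = theta i * gen (x i) * gen (d i) by
      rw [mul_assoc]; rfl, theta_mul_x_self]
    rw [mul_add, add_mul, ((commute_h (gen (x i))).pow_left 2).eq.symm]
    simp only [theta, mul_assoc]
  rw [opS, mul_add, e, mul_smul_comm, ((commute_h (theta i)).pow_left 2).eq.symm,
    smul_eq_smul_add (c i) 1, one_smul, add_assoc]

/-- Two commutators arise, whence the shift by `2`. The multiplier `x_j ∂_j²` occurs in S-pairs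
where the other leading monomial already contains one factor `x_j`. -/
lemma x_d_d_mul_x {m : ℕ} (c : Fin m → ℂ) (i : Fin m) :
    gen (x i) * gen (d i) * gen (d i) * gen (x i) =
      opS c i - (c i - 2) • (gen h ^ 2 * theta i) := by
  have e : gen (x i) * gen (d i) * gen (d i) * gen (x i) =
      gen (x i) * gen (x i) * gen (d i) * gen (d i) +
        (gen h ^ 2 * theta i + gen h ^ 2 * theta i) := by
    have hd := d_mul_x i i
    rw [if_pos rfl] at hd
    have hc : ∀ f : HWeyl m, f * gen h ^ 2 = gen h ^ 2 * f := fun f =>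
      ((commute_h f).pow_left 2).eq.symm
    rw [mul_assoc _ (gen (d i)) (gen (x i)), hd, mul_add, ← mul_assoc,
      mul_assoc (gen (x i)) (gen (d i)) (gen (x i)), hd, mul_add, add_mul, hc, hc, mul_assoc (gen h ^ 2)]
    simp only [theta, mul_assoc, add_assoc]
  rw [e, opS_eq, eq_sub_iff_add_eq, smul_eq_smul_add (c i) 2, two_smul, add_assoc]

/-! ### Syzygies, in an arbitrary ring -/

section Syzygies

variable {A : Type*} [Ring A]

/-- The terms containing `h` cancel, and `T_{ij} S_{ab}` is left. -/
lemma syzygy_T_T {h xi xj Si Sj Sab Sab' : A} (hi : Commute h Si) (hj : Commute h Sj)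
    (hS : Commute Si Sj) (hij : Commute xi Sj) (hji : Commute xj Si)
    (hab : (xj * Si - xi * Sj) * Sab = Sab' * (xj * Si - xi * Sj)) :
    Sj * (h * Si - xi * Sab) - Si * (h * Sj - xj * Sab) = Sab' * (xj * Si - xi * Sj) := by
  rw [← hab]
  have e1 : Sj * (h * Si) = Si * (h * Sj) := by
    rw [← mul_assoc, ← hj.eq, mul_assoc, ← hS.eq, ← mul_assoc, hi.eq, mul_assoc]
  rw [mul_sub, mul_sub, e1, sub_sub_sub_cancel_left, sub_mul, hji.eq, hij.eq, mul_assoc, mul_assoc]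

lemma syzygy_T_TT {h xi xj Si Sj Sab : A} (hx : Commute xi xj) (hi : Commute h xi)
    (hj : Commute h xj) :
    xj * (h * Si - xi * Sab) - h * (xj * Si - xi * Sj) = xi * (h * Sj - xj * Sab) := by
  rw [mul_sub, mul_sub, mul_sub, ← mul_assoc, ← mul_assoc, ← mul_assoc, ← mul_assoc, ← mul_assoc,
    ← mul_assoc, hx.eq, hi.eq, hj.eq]
  abel

lemma syzygy_TT_TT {xi xj xk Si Sj Sk : A} (hij : Commute xi Sj) (hji : Commute xj Si)
    (hik : Commute xi Sk) (hjk : Commute xj Sk) (hki : Commute xk Si) (hkj : Commute xk Sj)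
    (hSij : Commute Si Sj) (hSik : Commute Si Sk) (hSjk : Commute Sj Sk) :
    Sj * (xk * Si - xi * Sk) - Si * (xk * Sj - xj * Sk) = Sk * (xj * Si - xi * Sj) := by
  have e1 : Sj * (xk * Si) = Si * (xk * Sj) := by
    rw [← mul_assoc, ← hkj.eq, mul_assoc, ← hSij.eq, ← mul_assoc, hki.eq, mul_assoc]
  have e2 : Si * (xj * Sk) = Sk * (xj * Si) := by
    rw [← mul_assoc, ← hji.eq, mul_assoc, hSik.eq, ← mul_assoc, hjk.eq, mul_assoc]
  have e3 : Sj * (xi * Sk) = Sk * (xi * Sj) := by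
    rw [← mul_assoc, ← hij.eq, mul_assoc, hSjk.eq, ← mul_assoc, hik.eq, mul_assoc]
  rw [mul_sub, mul_sub, mul_sub, e1, e2, e3, sub_sub_sub_cancel_left]

lemma syzygy_x_TT {xi xj xk Si Sj Sk : A} (hij : Commute xi xj) (hik : Commute xi xk)
    (hjk : Commute xj xk) :
    xk * (xj * Si - xi * Sj) - xj * (xk * Si - xi * Sk) = -(xi * (xk * Sj - xj * Sk)) := by
  rw [mul_sub, mul_sub, mul_sub, ← mul_assoc, ← mul_assoc, ← mul_assoc, ← mul_assoc, ← mul_assoc,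
    ← mul_assoc, hjk.eq, hij.eq, hik.eq]
  abel

end Syzygies

/-! ### The leading monomials of the operators -/

lemma HasLead.mul_monic {m : ℕ} {f g : HWeyl m} {s t : HVar m →₀ ℕ} (hf : HasLead f s 1)
    (hg : HasLead g t 1) : HasLead (f * g) (s + t) 1 := by
  simpa using hf.mul hg

lemma hasLead_h_sq {m : ℕ} : HasLead (gen h ^ 2 : HWeyl m) (Finsupp.single h 2) 1 := by
  have := (hasLead_gen (h : HVar m)).mul_monic (hasLead_gen h)
  rwa [← pow_two, ← Finsupp.single_add] at this

/-- The exponent of `x_i ξ_i`. -/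
def expTheta {m : ℕ} (i : Fin m) : HVar m →₀ ℕ := Finsupp.single (x i) 1 + Finsupp.single (d i) 1

/-- The exponent of `x_i² ξ_i²`. -/
def expS {m : ℕ} (i : Fin m) : HVar m →₀ ℕ := Finsupp.single (x i) 2 + Finsupp.single (d i) 2

/-- The exponent of `h x_i² ξ_i²`. -/
def expT {m : ℕ} (i : Fin m) : HVar m →₀ ℕ := Finsupp.single h 1 + expS i

/-- The exponent of `x_j x_i² ξ_i²`. -/
def expTT {m : ℕ} (i j : Fin m) : HVar m →₀ ℕ := Finsupp.single (x j) 1 + expS i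

lemma expTheta_add_expTheta {m : ℕ} (i : Fin m) : expTheta i + expTheta i = expS i := by
  rw [expTheta, expS, add_add_add_comm, ← Finsupp.single_add, ← Finsupp.single_add]

lemma hasLead_theta {m : ℕ} (i : Fin m) : HasLead (theta i) (expTheta i) 1 :=
  (hasLead_gen _).mul_monic (hasLead_gen _)

lemma smul_h_sq_mem_lower {m : ℕ} (r : ℂ) (i : Fin m) : r • gen h ^ 2 ∈ lower (expTheta i) :=
  (lower _).smul_mem r (hasLead_h_sq.mem_lower (two_h_lt_x_d i))

lemma hasLead_opS {m : ℕ} (c : Fin m → ℂ) (i : Fin m) : HasLead (opS c i) (expS i) 1 := by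
  rw [← expTheta_add_expTheta]
  exact (hasLead_theta i).mul_monic ((hasLead_theta i).add_lower (smul_h_sq_mem_lower _ i))

lemma expTheta_lt {m : ℕ} {i j : Fin m} (hij : i < j) : expTheta j ≺[kmOrder m] expTheta i := by
  classical
  refine kmOrder_lt_of_lex ?_ ?_ i ?_ ?_ <;> simp [expTheta, Finsupp.single_apply]
  · intro k hk
    simp [hk.ne', (hk.trans hij).ne']
  · exact hij.ne'

/-- Lex favours the smallest index, so `θ_1` leads; positivity of `m` ensures that it occurs. -/
lemma hasLead_sum_theta {m : ℕ} (hm : 0 < m) (r : ℂ) :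
    HasLead (∑ i : Fin m, theta i + r • gen h ^ 2) (expTheta ⟨0, hm⟩) 1 := by
  rw [← Finset.add_sum_erase Finset.univ _ (Finset.mem_univ (⟨0, hm⟩ : Fin m))]
  refine ((hasLead_theta _).add_lower (sum_mem fun i hi => ?_)).add_lower
    (smul_h_sq_mem_lower _ _)
  exact (hasLead_theta i).mem_lower (expTheta_lt
    (lt_of_le_of_ne (Nat.zero_le _) (Finset.ne_of_mem_erase hi).symm))

lemma hasLead_opSab {m : ℕ} (hm : 0 < m) (a b : ℂ) :
    HasLead (opSab m a b) (expS ⟨0, hm⟩) 1 := by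
  rw [← expTheta_add_expTheta]
  exact (hasLead_sum_theta hm a).mul_monic (hasLead_sum_theta hm b)

lemma hasLead_opT {m : ℕ} (a b : ℂ) (c : Fin m → ℂ) (i : Fin m) :
    HasLead (opT a b c i) (expT i) 1 := by
  classical
  refine ((hasLead_gen h).mul_monic (hasLead_opS c i)).sub_lower
    (((hasLead_gen (x i)).mul_monic (hasLead_opSab i.pos a b)).mem_lower ?_)
  -- The total degrees agree; `x_i S_{ab}` leads in weight `-1`, but `h S_i` in weight `0`.
  refine kmOrder_lt_of_weight ?_ ?_ <;>
    simp [expS, Finsupp.single_apply, Finset.sum_add_distrib]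

lemma hasLead_opTT {m : ℕ} (c : Fin m → ℂ) {i j : Fin m} (hij : i < j) :
    HasLead (opTT c i j) (expTT i j) 1 := by
  classical
  refine ((hasLead_gen (x j)).mul_monic (hasLead_opS c i)).sub_lower
    (((hasLead_gen (x i)).mul_monic (hasLead_opS c j)).mem_lower ?_)
  refine kmOrder_lt_of_lex ?_ ?_ i ?_ ?_ <;>
    simp [expS, Finsupp.single_apply, Finset.sum_add_distrib]
  · intro k hk
    simp [hk.ne', (hk.trans hij).ne']
  · simp [hij.ne']

lemma normalMonomial_single {m : ℕ} (v : HVar m) :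
    normalMonomial (Finsupp.single v 1) = gen v := by
  rw [← add_zero (Finsupp.single v 1)]
  cases v with
  | h => rw [normalMonomial_h, normalMonomial_zero, mul_one]
  | x i => rw [normalMonomial_x, normalMonomial_zero, mul_one]
  | d i => rw [normalMonomial_d _ _ rfl fun _ => rfl, normalMonomial_zero, mul_one]

lemma normalMonomial_d_sq {m : ℕ} (i : Fin m) :
    normalMonomial (Finsupp.single (d i) 2) = gen (d i) * gen (d i) := by
  rw [show 2 = 1 + 1 from rfl, Finsupp.single_add, normalMonomial_d _ _ (by simp) (by simp),
    normalMonomial_single]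

lemma normalMonomial_expS {m : ℕ} (i : Fin m) :
    normalMonomial (expS i) = gen (x i) * gen (x i) * gen (d i) * gen (d i) := by
  rw [expS, show (2 : ℕ) = 1 + 1 from rfl, Finsupp.single_add (a := x i), add_assoc,
    normalMonomial_x, normalMonomial_x, normalMonomial_d_sq]
  simp only [mul_assoc]

lemma normalMonomial_expS_eq {m : ℕ} (c : Fin m → ℂ) (i : Fin m) :
    normalMonomial (expS i) = opS c i - c i • (gen h ^ 2 * theta i) := by
  rw [normalMonomial_expS, opS_eq, add_sub_cancel_right]

/-! ### The S-pairs -/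

lemma opT_mem_setG {m : ℕ} (a b : ℂ) (c : Fin m → ℂ) (i : Fin m) : opT a b c i ∈ setG a b c :=
  Or.inl ⟨i, rfl⟩

lemma opTT_mem_setG {m : ℕ} (a b : ℂ) (c : Fin m → ℂ) {i j : Fin m} (hij : i < j) :
    opTT c i j ∈ setG a b c := Or.inr ⟨i, j, hij, rfl⟩

lemma opS_opT_syzygy {m : ℕ} (a b : ℂ) (c : Fin m → ℂ) {i j : Fin m} (hij : i ≠ j) :
    opS c j * opT a b c i - opS c i * opT a b c j =
      opSab m (a - 1) (b - 1) * opTT c i j :=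
  syzygy_T_T (commute_h _) (commute_h _) (commute_opS_opS c i j) (commute_x_opS c hij)
    (commute_x_opS c hij.symm) (opTT_mul_opSab a b c i j)

lemma opT_opTT_syzygy {m : ℕ} (a b : ℂ) (c : Fin m → ℂ) (i j : Fin m) :
    gen (x j) * opT a b c i - gen h * opTT c i j = gen (x i) * opT a b c j :=
  syzygy_T_TT (commute_x_x i j) (commute_h _) (commute_h _)

lemma opTT_syzygy {m : ℕ} (c : Fin m → ℂ) (i j k : Fin m) :
    gen (x k) * opTT c i j - gen (x j) * opTT c i k = -(gen (x i) * opTT c j k) :=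
  syzygy_x_TT (commute_x_x i j) (commute_x_x i k) (commute_x_x j k)

lemma opS_opTT_syzygy {m : ℕ} (c : Fin m → ℂ) {i j k : Fin m} (hij : i ≠ j) (hik : i ≠ k)
    (hjk : j ≠ k) :
    opS c j * opTT c i k - opS c i * opTT c j k = opS c k * opTT c i j :=
  syzygy_TT_TT (commute_x_opS c hij) (commute_x_opS c hij.symm) (commute_x_opS c hik)
    (commute_x_opS c hjk) (commute_x_opS c hik.symm) (commute_x_opS c hjk.symm)
    (commute_opS_opS c i j) (commute_opS_opS c i k) (commute_opS_opS c j k)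

lemma hasStandardRep_sPair_opT_opT {m : ℕ} (a b : ℂ) (c : Fin m → ℂ) {i j : Fin m} (hij : i < j) :
    HasStandardRep (setG a b c) (sPair (opT a b c i) (opT a b c j)) := by
  classical
  refine hasStandardRep_sPair (hasLead_opT a b c i) (hasLead_opT a b c j) (w := expS j)
    (w' := expS i) ?_ ?_ ?_
  · rintro (_ | k | k) <;> simp [expT, expS, Finsupp.single_apply] <;> grind
  · rintro (_ | k | k) <;> simp [expT, expS, Finsupp.single_apply] <;> grind
  -- The first summand is the syzygy; the other two come from replacing `x_j² ∂_j²` and `x_i² ∂_i²`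
  -- by `S_j` and `S_i`.
  have key := hasStandardRep_of_leads (G := setG a b c) ![1, -c j, c i]
    ![opSab m (a - 1) (b - 1), gen h ^ 2 * theta j, gen h ^ 2 * theta i]
    ![opTT c i j, opT a b c i, opT a b c j]
    ![expS ⟨0, i.pos⟩, Finsupp.single h 2 + expTheta j, Finsupp.single h 2 + expTheta i]
    ![expTT i j, expT i, expT j]
    (by simp [Fin.forall_fin_succ, opT_mem_setG, opTT_mem_setG, hij])
    (by simp [Fin.forall_fin_succ, hasLead_opSab, hasLead_h_sq.mul_monic, hasLead_theta])
    (by simp [Fin.forall_fin_succ, hasLead_opT, hasLead_opTT, hij])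
    (by
      intro u v huv
      -- The exponents of `h` are `0, 3, 3`, and those of `ξ_i` in the last two are `2, 1`. The same
      -- two variables separate the summands in the later multi-term S-pairs.
      have e0 := DFunLike.congr_fun huv h
      have e1 := DFunLike.congr_fun huv (d i)
      fin_cases u <;> fin_cases v <;>
        simp [expS, expTheta, expT, expTT, Finsupp.single_apply, hij.ne] at e0 e1 ⊢)
  convert key using 1
  rw [normalMonomial_expS_eq c, normalMonomial_expS_eq c, Fin.sum_univ_three]
  have e := opS_opT_syzygy a b c hij.ne
  simp only [Matrix.cons_val, sub_mul, smul_mul_assoc, ← e]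
  module

/-- The S-pair is exactly `x_i T_j`, so there is nothing to cancel. -/
lemma hasStandardRep_sPair_opT_opTT_left {m : ℕ} (a b : ℂ) (c : Fin m → ℂ) {i j : Fin m}
    (hij : i < j) : HasStandardRep (setG a b c) (sPair (opT a b c i) (opTT c i j)) := by
  classical
  refine hasStandardRep_sPair (hasLead_opT a b c i) (hasLead_opTT c hij)
    (w := Finsupp.single (x j) 1) (w' := Finsupp.single h 1) ?_ ?_ ?_
  · rintro (_ | k | k) <;> simp [expT, expTT, expS]
  · rintro (_ | k | k) <;> simp [expT, expTT, expS]
  have key := hasStandardRep_of_leads (G := setG a b c) (n := 1) (fun _ => 1)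
    (fun _ => gen (x i)) (fun _ => opT a b c j) (fun _ => Finsupp.single (x i) 1)
    (fun _ => expT j) (fun _ => opT_mem_setG a b c j) (fun _ => hasLead_gen _)
    (fun _ => hasLead_opT a b c j) (fun _ _ _ => Subsingleton.elim _ _)
  rw [normalMonomial_single, normalMonomial_single, opT_opTT_syzygy]
  simpa using key

lemma hasStandardRep_sPair_opTT_opTT_same_left {m : ℕ} (a b : ℂ) (c : Fin m → ℂ) {i j k : Fin m}
    (hij : i < j) (hjk : j < k) :
    HasStandardRep (setG a b c) (sPair (opTT c i j) (opTT c i k)) := by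
  classical
  refine hasStandardRep_sPair (hasLead_opTT c hij) (hasLead_opTT c (hij.trans hjk))
    (w := Finsupp.single (x k) 1) (w' := Finsupp.single (x j) 1) ?_ ?_ ?_
  · rintro (_ | l | l) <;> simp [expTT, expS, Finsupp.single_apply]; grind
  · rintro (_ | l | l) <;> simp [expTT, expS, Finsupp.single_apply]; grind
  have key := hasStandardRep_of_leads (G := setG a b c) (n := 1) (fun _ => -1)
    (fun _ => gen (x i)) (fun _ => opTT c j k) (fun _ => Finsupp.single (x i) 1)
    (fun _ => expTT j k) (fun _ => opTT_mem_setG a b c hjk) (fun _ => hasLead_gen _)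
    (fun _ => hasLead_opTT c hjk) (fun _ _ _ => Subsingleton.elim _ _)
  rw [normalMonomial_single, normalMonomial_single, opTT_syzygy]
  convert key using 1
  rw [Fin.sum_univ_one]
  module

lemma x_d_d_mul_sub {m : ℕ} (c : Fin m → ℂ) {i j : Fin m} (hij : i ≠ j) (p q : HWeyl m) :
    gen (x j) * gen (d j) * gen (d j) * (gen (x j) * p - gen (x i) * q) =
      opS c j * p - (c j - 2) • (gen h ^ 2 * theta j * p) -
        gen (x i) * (gen (x j) * gen (d j) * gen (d j)) * q := by
  have hc : Commute (gen (x i)) (gen (x j) * gen (d j) * gen (d j)) :=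
    ((commute_x_x i j).mul_right (commute_d_x hij.symm).symm).mul_right (commute_d_x hij.symm).symm
  rw [mul_sub, ← mul_assoc, ← mul_assoc, x_d_d_mul_x c, hc.eq, sub_mul, smul_mul_assoc]

lemma normalMonomial_x_d_d {m : ℕ} (j : Fin m) :
    normalMonomial (Finsupp.single (x j) 1 + Finsupp.single (d j) 2) =
      gen (x j) * gen (d j) * gen (d j) := by
  rw [normalMonomial_x, normalMonomial_d_sq, mul_assoc]

lemma hasStandardRep_sPair_opT_opTT_right {m : ℕ} (a b : ℂ) (c : Fin m → ℂ) {i j : Fin m}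
    (hij : i < j) : HasStandardRep (setG a b c) (sPair (opT a b c j) (opTT c i j)) := by
  classical
  refine hasStandardRep_sPair (hasLead_opT a b c j) (hasLead_opTT c hij) (w := expS i)
    (w' := Finsupp.single h 1 + (Finsupp.single (x j) 1 + Finsupp.single (d j) 2)) ?_ ?_ ?_
  · rintro (_ | k | k) <;> simp [expT, expTT, expS, Finsupp.single_apply] <;> grind
  · rintro (_ | k | k) <;> simp [expT, expTT, expS, Finsupp.single_apply] <;> grind
  -- Substitute `h T_{ij} = x_j T_i - x_i T_j` into `x_j ∂_j² h T_{ij}`: the first part yields `S_j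
  -- T_i` with the correction `c_j - 2`, the second the summand `x_i x_j ∂_j² T_j`.
  have key := hasStandardRep_of_leads (G := setG a b c) ![1, -c i, -1, c j - 2]
    ![gen (x i) * normalMonomial (Finsupp.single (x j) 1 + Finsupp.single (d j) 2),
      gen h ^ 2 * theta i, opSab m (a - 1) (b - 1), gen h ^ 2 * theta j]
    ![opT a b c j, opT a b c j, opTT c i j, opT a b c i]
    ![Finsupp.single (x i) 1 + (Finsupp.single (x j) 1 + Finsupp.single (d j) 2),
      Finsupp.single h 2 + expTheta i, expS ⟨0, i.pos⟩, Finsupp.single h 2 + expTheta j]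
    ![expT j, expT j, expTT i j, expT i]
    (by simp [Fin.forall_fin_succ, opT_mem_setG, opTT_mem_setG, hij])
    (by simp [Fin.forall_fin_succ, hasLead_opSab, hasLead_h_sq.mul_monic, hasLead_theta,
      (hasLead_gen _).mul_monic, hasLead_normalMonomial])
    (by simp [Fin.forall_fin_succ, hasLead_opT, hasLead_opTT, hij])
    (by
      intro u v huv
      have e0 := DFunLike.congr_fun huv h
      have e1 := DFunLike.congr_fun huv (d i)
      fin_cases u <;> fin_cases v <;>
        simp [expS, expTheta, expT, expTT, Finsupp.single_apply, hij.ne'] at e0 e1 ⊢)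
  convert key using 1
  have e1 := opS_opT_syzygy a b c hij.ne
  rw [normalMonomial_expS_eq c, normalMonomial_h, normalMonomial_x_d_d, (commute_h _).eq,
    mul_assoc _ (gen h), ← sub_sub_self (gen (x j) * opT a b c i) (gen h * _), opT_opTT_syzygy,
    x_d_d_mul_sub c hij.ne, Fin.sum_univ_four]
  simp only [Matrix.cons_val, sub_mul, smul_mul_assoc, ← e1]
  module

lemma hasStandardRep_sPair_opTT_opTT_same_right {m : ℕ} (a b : ℂ) (c : Fin m → ℂ)
    {i j k : Fin m} (hij : i < j) (hjk : j < k) :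
    HasStandardRep (setG a b c) (sPair (opTT c i k) (opTT c j k)) := by
  classical
  have hik := hij.trans hjk
  refine hasStandardRep_sPair (hasLead_opTT c hik) (hasLead_opTT c hjk)
    (w := expS j) (w' := expS i) ?_ ?_ ?_
  · rintro (_ | l | l) <;> simp [expTT, expS, Finsupp.single_apply] <;> grind
  · rintro (_ | l | l) <;> simp [expTT, expS, Finsupp.single_apply] <;> grind
  have key := hasStandardRep_of_leads (G := setG a b c) ![1, -c j, c i]
    ![opS c k, gen h ^ 2 * theta j, gen h ^ 2 * theta i]
    ![opTT c i j, opTT c i k, opTT c j k]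
    ![expS k, Finsupp.single h 2 + expTheta j, Finsupp.single h 2 + expTheta i]
    ![expTT i j, expTT i k, expTT j k]
    (by simp [Fin.forall_fin_succ, opTT_mem_setG, hij, hjk, hik])
    (by simp [Fin.forall_fin_succ, hasLead_opS, hasLead_h_sq.mul_monic, hasLead_theta])
    (by simp [Fin.forall_fin_succ, hasLead_opTT, hij, hjk, hik])
    (by
      intro u v huv
      have e0 := DFunLike.congr_fun huv h
      have e1 := DFunLike.congr_fun huv (d i)
      fin_cases u <;> fin_cases v <;>
        simp [expS, expTheta, expTT, Finsupp.single_apply, hij.ne'] at e0 e1 ⊢)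
  convert key using 1
  have e := opS_opTT_syzygy c hij.ne hik.ne hjk.ne
  rw [normalMonomial_expS_eq c, normalMonomial_expS_eq c, Fin.sum_univ_three]
  simp only [Matrix.cons_val, sub_mul, smul_mul_assoc, ← e]
  module

lemma hasStandardRep_sPair_opTT_opTT_chain {m : ℕ} (a b : ℂ) (c : Fin m → ℂ)
    {i j k : Fin m} (hij : i < j) (hjk : j < k) :
    HasStandardRep (setG a b c) (sPair (opTT c i j) (opTT c j k)) := by
  classical
  have hik := hij.trans hjk
  refine hasStandardRep_sPair (hasLead_opTT c hij) (hasLead_opTT c hjk)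
    (w := Finsupp.single (x k) 1 + (Finsupp.single (x j) 1 + Finsupp.single (d j) 2))
    (w' := expS i) ?_ ?_ ?_
  · rintro (_ | l | l) <;> simp [expTT, expS, Finsupp.single_apply] <;> grind
  · rintro (_ | l | l) <;> simp [expTT, expS, Finsupp.single_apply] <;> grind
  -- Here `x_k T_{ij} = x_j T_{ik} - x_i T_{jk}` is substituted before applying `x_j ∂_j²`.
  have key := hasStandardRep_of_leads (G := setG a b c) ![1, 2 - c j, c i, -1]
    ![opS c k, gen h ^ 2 * theta j, gen h ^ 2 * theta i,
      gen (x i) * normalMonomial (Finsupp.single (x j) 1 + Finsupp.single (d j) 2)]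
    ![opTT c i j, opTT c i k, opTT c j k, opTT c j k]
    ![expS k, Finsupp.single h 2 + expTheta j, Finsupp.single h 2 + expTheta i,
      Finsupp.single (x i) 1 + (Finsupp.single (x j) 1 + Finsupp.single (d j) 2)]
    ![expTT i j, expTT i k, expTT j k, expTT j k]
    (by simp [Fin.forall_fin_succ, opTT_mem_setG, hij, hjk, hik])
    (by simp [Fin.forall_fin_succ, hasLead_opS, hasLead_h_sq.mul_monic, hasLead_theta,
      (hasLead_gen _).mul_monic, hasLead_normalMonomial])
    (by simp [Fin.forall_fin_succ, hasLead_opTT, hij, hjk, hik])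
    (by
      intro u v huv
      have e0 := DFunLike.congr_fun huv h
      have e1 := DFunLike.congr_fun huv (d i)
      fin_cases u <;> fin_cases v <;>
        simp [expS, expTheta, expTT, hij.ne', hik.ne'] at e0 e1 ⊢)
  convert key using 1
  have e1 := opS_opTT_syzygy c hij.ne hik.ne hjk.ne
  have hc : Commute (gen (x k)) (gen (x j) * gen (d j) * gen (d j)) :=
    ((commute_x_x k j).mul_right (commute_d_x hjk.ne).symm).mul_right (commute_d_x hjk.ne).symm
  have e2 : gen (x k) * opTT c i j = gen (x j) * opTT c i k - gen (x i) * opTT c j k := by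
    rw [sub_eq_add_neg, ← opTT_syzygy c i j k]; abel
  rw [normalMonomial_expS_eq c, normalMonomial_x, normalMonomial_x_d_d, hc.eq,
    mul_assoc _ (gen (x k)), e2, x_d_d_mul_sub c hij.ne, Fin.sum_univ_four]
  simp only [Matrix.cons_val, sub_mul, smul_mul_assoc, ← e1]
  module

/-- The product criterion: the leading monomials are coprime and the operators commute. Writing each
multiplier as the other operator minus its tail makes the products `T_{kl} T_{ij}` cancel. -/
lemma hasStandardRep_sPair_opTT_opTT_disjoint {m : ℕ} (a b : ℂ) (c : Fin m → ℂ)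
    {i j k l : Fin m} (hij : i < j) (hkl : k < l) (hik : i ≠ k) (hil : i ≠ l) (hjk : j ≠ k)
    (hjl : j ≠ l) :
    HasStandardRep (setG a b c) (sPair (opTT c i j) (opTT c k l)) := by
  classical
  refine hasStandardRep_sPair (hasLead_opTT c hij) (hasLead_opTT c hkl)
    (w := Finsupp.single (x l) 1 + expS k) (w' := Finsupp.single (x j) 1 + expS i) ?_ ?_ ?_
  · rintro (_ | n | n) <;> simp [expTT, expS, Finsupp.single_apply] <;> grind
  · rintro (_ | n | n) <;> simp [expTT, expS, Finsupp.single_apply] <;> grind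
  have key := hasStandardRep_of_leads (G := setG a b c) ![1, -c k, -1, c i]
    ![gen (x k) * opS c l, gen (x l) * (gen h ^ 2 * theta k), gen (x i) * opS c j,
      gen (x j) * (gen h ^ 2 * theta i)]
    ![opTT c i j, opTT c i j, opTT c k l, opTT c k l]
    ![Finsupp.single (x k) 1 + expS l,
      Finsupp.single (x l) 1 + (Finsupp.single h 2 + expTheta k),
      Finsupp.single (x i) 1 + expS j,
      Finsupp.single (x j) 1 + (Finsupp.single h 2 + expTheta i)]
    ![expTT i j, expTT i j, expTT k l, expTT k l]
    (by simp [Fin.forall_fin_succ, opTT_mem_setG, hij, hkl])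
    (by simp [Fin.forall_fin_succ, hasLead_opS, hasLead_h_sq.mul_monic, hasLead_theta,
      (hasLead_gen _).mul_monic])
    (by simp [Fin.forall_fin_succ, hasLead_opTT, hij, hkl])
    (by
      intro u v huv
      have e0 := DFunLike.congr_fun huv h
      have e1 := DFunLike.congr_fun huv (d i)
      fin_cases u <;> fin_cases v <;>
        simp [expS, expTheta, expTT, hij.ne', hik.symm, hil.symm] at e0 e1 ⊢)
  convert key using 1
  have hSx : ∀ {p q r s : Fin m}, p ≠ q → r ≠ s →
      Commute (gen (x p) * opS c s) (gen (x r) * opS c q) := fun hpq hrs =>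
    (((commute_x_x _ _).mul_right (commute_x_opS c hpq)).mul_left
      ((commute_x_opS c hrs).symm.mul_right (commute_opS_opS c _ _)))
  have e1 : opTT c k l * opTT c i j = opTT c i j * opTT c k l :=
    (((hSx hil.symm hjk).sub_right (hSx hjl.symm hik)).sub_left
      ((hSx hik.symm hjl).sub_right (hSx hjk.symm hil))).eq
  have e2 : ∀ k l : Fin m, gen (x l) * normalMonomial (expS k) =
      opTT c k l + gen (x k) * opS c l - c k • (gen (x l) * (gen h ^ 2 * theta k)) := by
    intro k l
    rw [normalMonomial_expS_eq c, mul_sub, mul_smul_comm, opTT, sub_add_cancel]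
  rw [normalMonomial_x, normalMonomial_x, e2, e2, Fin.sum_univ_four]
  simp only [Matrix.cons_val, sub_mul, add_mul, smul_mul_assoc, e1]
  module

/-- Antisymmetry handles both orders of the indices; of the leading exponent, only the absence of
`h` is needed later. -/
lemma exists_smul_opTT {m : ℕ} (a b : ℂ) (c : Fin m → ℂ) {i j : Fin m} (hij : i ≠ j) :
    ∃ (r : ℂ) (g : HWeyl m) (e : HVar m →₀ ℕ), g ∈ setG a b c ∧ HasLead g e 1 ∧ e h = 0 ∧
      opTT c i j = r • g := by
  rcases lt_or_gt_of_ne hij with hlt | hlt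
  · exact ⟨1, _, _, opTT_mem_setG a b c hlt, hasLead_opTT c hlt, by simp [expTT, expS],
      (one_smul _ _).symm⟩
  · refine ⟨-1, _, _, opTT_mem_setG a b c hlt, hasLead_opTT c hlt, by simp [expTT, expS], ?_⟩
    rw [opTT, opTT]
    module

/-- The leading monomials are coprime, but `S_{ab}` obstructs commutation of the operators. Instead,
`h T_{ij} = x_j T_i - x_i T_j` reduces the pair to `x_j` times the syzygy of `T_k` and `T_i`, plus
`x_i x_k² ∂_k² T_j` and corrections. -/
lemma hasStandardRep_sPair_opT_opTT_disjoint {m : ℕ} (a b : ℂ) (c : Fin m → ℂ) {i j k : Fin m}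
    (hij : i < j) (hki : k ≠ i) (hkj : k ≠ j) :
    HasStandardRep (setG a b c) (sPair (opT a b c k) (opTT c i j)) := by
  classical
  refine hasStandardRep_sPair (hasLead_opT a b c k) (hasLead_opTT c hij)
    (w := Finsupp.single (x j) 1 + expS i) (w' := Finsupp.single h 1 + expS k) ?_ ?_ ?_
  · rintro (_ | n | n) <;> simp [expT, expTT, expS, Finsupp.single_apply] <;> grind
  · rintro (_ | n | n) <;> simp [expT, expTT, expS, Finsupp.single_apply] <;> grind
  obtain ⟨r, g, e, hg, hge, he, hr⟩ := exists_smul_opTT a b c hki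
  have key := hasStandardRep_of_leads (G := setG a b c) ![r, 1, -c i, c k]
    ![gen (x j) * opSab m (a - 1) (b - 1), gen (x i) * normalMonomial (expS k),
      gen (x j) * (gen h ^ 2 * theta i), gen (x j) * (gen h ^ 2 * theta k)]
    ![g, opT a b c j, opT a b c k, opT a b c i]
    ![Finsupp.single (x j) 1 + expS ⟨0, i.pos⟩, Finsupp.single (x i) 1 + expS k,
      Finsupp.single (x j) 1 + (Finsupp.single h 2 + expTheta i),
      Finsupp.single (x j) 1 + (Finsupp.single h 2 + expTheta k)]
    ![e, expT j, expT k, expT i]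
    (by simp [Fin.forall_fin_succ, opT_mem_setG, hg])
    (by simp [Fin.forall_fin_succ, hasLead_opSab, hasLead_h_sq.mul_monic, hasLead_theta,
      (hasLead_gen _).mul_monic, hasLead_normalMonomial])
    (by simp [Fin.forall_fin_succ, hasLead_opT, hge])
    (by
      intro u v huv
      have e0 := DFunLike.congr_fun huv h
      have e1 := DFunLike.congr_fun huv (d i)
      fin_cases u <;> fin_cases v <;>
        simp [expS, expTheta, expT, Finsupp.single_apply, he, hki] at e0 e1 ⊢)
  convert key using 1
  have e1 := opS_opT_syzygy a b c hki
  have hx : ∀ l, k ≠ l → gen (x l) * normalMonomial (expS k) =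
      normalMonomial (expS k) * gen (x l) := by
    intro l hl
    rw [normalMonomial_expS_eq c]
    exact ((commute_x_opS c hl.symm).sub_right (((commute_h _).pow_left 2).symm.mul_right
      (commute_x_theta hl.symm) |>.smul_right _)).eq
  have e2 : gen h * normalMonomial (expS k) * opTT c i j =
      gen (x j) * (normalMonomial (expS k) * opT a b c i) -
        gen (x i) * (normalMonomial (expS k) * opT a b c j) := by
    rw [(commute_h _).eq, mul_assoc, ← sub_sub_self (gen (x j) * opT a b c i) (gen h * _),
      opT_opTT_syzygy, mul_sub, ← mul_assoc, ← mul_assoc, ← hx j hkj, ← hx i hki, mul_assoc,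
      mul_assoc]
  rw [normalMonomial_x, normalMonomial_h, e2, Fin.sum_univ_four]
  simp only [Matrix.cons_val]
  rw [← mul_smul_comm, ← hr, mul_assoc (gen (x j)) (opSab m _ _), ← e1]
  simp only [normalMonomial_expS_eq c i, normalMonomial_expS_eq c k, mul_sub, sub_mul,
    smul_mul_assoc, mul_smul_comm, mul_assoc]
  module

lemma hasStandardRep_sPair_opT_opTT {m : ℕ} (a b : ℂ) (c : Fin m → ℂ) {i j : Fin m} (hij : i < j)
    (k : Fin m) : HasStandardRep (setG a b c) (sPair (opT a b c k) (opTT c i j)) := by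
  rcases eq_or_ne k i with rfl | hki
  · exact hasStandardRep_sPair_opT_opTT_left a b c hij
  rcases eq_or_ne k j with rfl | hkj
  · exact hasStandardRep_sPair_opT_opTT_right a b c hij
  exact hasStandardRep_sPair_opT_opTT_disjoint a b c hij hki hkj

lemma hasStandardRep_sPair_opTT_opTT_of_lt {m : ℕ} (a b : ℂ) (c : Fin m → ℂ) {i j k l : Fin m}
    (hij : i < j) (hkl : k < l) (hik : i < k) :
    HasStandardRep (setG a b c) (sPair (opTT c i j) (opTT c k l)) := by
  rcases eq_or_ne j k with rfl | hjk
  · exact hasStandardRep_sPair_opTT_opTT_chain a b c hij hkl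
  rcases eq_or_ne j l with rfl | hjl
  · exact hasStandardRep_sPair_opTT_opTT_same_right a b c hik hkl
  exact hasStandardRep_sPair_opTT_opTT_disjoint a b c hij hkl hik.ne (hik.trans hkl).ne hjk hjl

lemma HasStandardRep.sPair_swap {m : ℕ} {G : Set (HWeyl m)} {f g : HWeyl m}
    (hfg : HasStandardRep G (sPair f g)) : HasStandardRep G (sPair g f) := by
  rw [LauricellaFC.sPair_swap]; exact hfg.neg

lemma sPairCriterion_setG {m : ℕ} (a b : ℂ) (c : Fin m → ℂ) : SPairCriterion (setG a b c) := by
  rintro f (⟨i, rfl⟩ | ⟨i, j, hij, rfl⟩) g (⟨k, rfl⟩ | ⟨k, l, hkl, rfl⟩)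
  · rcases lt_trichotomy i k with hik | rfl | hik
    · exact hasStandardRep_sPair_opT_opT a b c hik
    · rw [sPair_self]; exact hasStandardRep_zero _
    · exact (hasStandardRep_sPair_opT_opT a b c hik).sPair_swap
  · exact hasStandardRep_sPair_opT_opTT a b c hkl i
  · exact (hasStandardRep_sPair_opT_opTT a b c hij k).sPair_swap
  · rcases lt_trichotomy i k with hik | rfl | hik
    · exact hasStandardRep_sPair_opTT_opTT_of_lt a b c hij hkl hik
    · rcases lt_trichotomy j l with hjl | rfl | hjl
      · exact hasStandardRep_sPair_opTT_opTT_same_left a b c hij hjl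
      · rw [sPair_self]; exact hasStandardRep_zero _
      · exact (hasStandardRep_sPair_opTT_opTT_same_left a b c hkl hjl).sPair_swap
    · exact (hasStandardRep_sPair_opTT_opTT_of_lt a b c hkl hij hik).sPair_swap

lemma setG_finite {m : ℕ} (a b : ℂ) (c : Fin m → ℂ) : (setG a b c).Finite := by
  refine Set.Finite.union ?_ ?_
  · exact (Set.finite_range (opT a b c)).subset fun f ⟨i, hi⟩ => ⟨i, hi.symm⟩
  · exact (Set.finite_range fun p : Fin m × Fin m => opTT c p.1 p.2).subset
      fun f ⟨i, j, _, hf⟩ => ⟨(i, j), hf.symm⟩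

end LauricellaFC

end

theorem mainTheorem5 (m : ℕ) (a b : ℂ) (c : Fin m → ℂ) :
    LauricellaFC.SPairCriterion (LauricellaFC.setG a b c) ∧
      LauricellaFC.IsGroebnerBasis (LauricellaFC.setG a b c)
        (Ideal.span (LauricellaFC.setG a b c)) :=
  ⟨LauricellaFC.sPairCriterion_setG a b c,
    (LauricellaFC.sPairCriterion_setG a b c).isGroebnerBasis (LauricellaFC.setG_finite a b c)⟩
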